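/- Conventions. Simplicial complexes are finite and contain the empty simplex. A complex is \emph{flag} if every set of vertices that are pairwise joined by edges is a simplex. $\mathrm{Lk}_\sigma(X)=\{\tau\in X: \sigma\cap\tau=\emptyset,\ \sigma\cup\tau\in X\}$, the join is $X*Y=\{\sigma\sqcup\tau:\sigma\in X,\tau\in Y\}$, and for an edge $\eta=\{s,t\}$ and a new vertex $e$ the subdivision of $X$ along $\eta$ is $$\mathrm{Sub}_\eta(X)=\{\sigma\in X:\eta\not\subset\sigma\}\cup\{\sigma\cup\{e\},\ \sigma\cup\{s,e\},\ \sigma\cup\{t,e\}:\sigma\in\mathrm{Lk}_\eta(X)\}.$$ The $m$-gon is the cyclic triangulation of the circle with $m$ vertices (pentagon: $m=5$, quadrilateral: $m=4$), and the cross-polytope $O^n$ is the $n$-fold join of $S^0$ (two points). A \emph{triangulation of $S^n$} is a complex whose geometric realization is homeomorphic to $S^n$; it is \emph{convex} if it can be realized as the boundary complex of an $(n+1)$-dimensional convex polytope. For $X$ of dimension $n-1$ put $f_X(t)=\sum_{\sigma\in X}t^{\#\sigma}$ and define $h_X$ by $(1+t)^n h_X\left(\frac1{1+t}\right)=t^n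 f_X\left(\frac1t\right)$, and $\gamma_X$ (of degree at most $\frac12\deg h_X$) by $h_X(t)=(1+t)^{\deg h_X}\gamma_X\left(\frac{t}{(1+t)^2}\right)$. Statement. Let $X_1$ be the join of two pentagons. Then $X_1$ has an edge whose link is isomorphic to a quadrilateral. For every such edge $\eta$, let $X_2=\mathrm{Sub}_\eta(X_1)$ and let $X$ be the join of $X_2$ with a pentagon. Then: (1) $X$ is a convex flag triangulation of $S^5$ and $\gamma_X(t)=1+4t+4t^2+t^3$. (2) $X$ has an edge whose link is isomorphic to the cross-polytope $O^4$. For every such edge $\theta$, the complex $X'=\mathrm{Sub}_\theta(X)$ is a convex flag triangulation of $S^5$, its $f$-polynomial is $1+17t+109t^2+345t^3+575t^4+483t^5+161t^6$, and $h_{X'}$ has a non-real root. Moreover $X'$ again has an edge whose link is isomorphic to $O^4$, and for every such edge $\kappa$ of $X'$, $\mathrm{Sub}_\kappa(X')$ is a convex flag triangulation of $S^5$ whose $h$-polynomial has a non-real root. (3) For every such $X'$, every $k\ge 0$ and every flag triangulation $Y$ of $S^k$, the join $X'*Y$ is a flag triangulation of $S^{k+6}$ whose $h$-polynomial has a non-real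 root; if $Y$ is convex, then so is $X'*Y$. (4) For every $n\ge5$ there is a convex flag triangulation of $S^n$ whose $h$-polynomial has a non-real root. -/

import Mathlib

open Polynomial

namespace PreAbstractSimplicialComplex

variable {V W : Type*}

/-- The simplices of `K`, the empty one included. (The field `faces` lists the nonempty ones.) -/
def IsSimplex (K : PreAbstractSimplicialComplex V) (σ : Finset V) : Prop :=
  σ = ∅ ∨ σ ∈ K.faces

theorem IsSimplex.mono {K : PreAbstractSimplicialComplex V} {σ τ : Finset V}
    (h : K.IsSimplex σ) (hτ : τ ⊆ σ) : K.IsSimplex τ := by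
  rcases τ.eq_empty_or_nonempty with rfl | hne
  · exact Or.inl rfl
  · rcases h with rfl | h
    · exact Or.inl (Finset.subset_empty.mp hτ)
    · exact Or.inr ((K.isRelLowerSet_faces h).2 hτ hne)

/-- The complex whose nonempty simplices are the nonempty members of a family of finite sets that
is closed under passing to subsets. -/
def ofSimplices (P : Finset V → Prop) (hP : ∀ σ τ, P σ → τ ⊆ σ → P τ) :
    PreAbstractSimplicialComplex V where
  faces := {σ | σ.Nonempty ∧ P σ}
  isRelLowerSet_faces := fun _ hσ => ⟨hσ.1, fun _ hτ hne => ⟨hne, hP _ _ hσ.2 hτ⟩⟩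

/-- An edge is a face with exactly two vertices. -/
def IsEdge (K : PreAbstractSimplicialComplex V) (η : Finset V) : Prop :=
  η ∈ K.faces ∧ η.card = 2

/-- A complex is flag if every finite set of vertices, any two distinct ones of which are joined by
an edge, is a simplex. -/
def IsFlag [DecidableEq V] (K : PreAbstractSimplicialComplex V) : Prop :=
  ∀ T : Finset V, (∀ v ∈ T, {v} ∈ K.faces) →
    (∀ v ∈ T, ∀ w ∈ T, v ≠ w → K.IsEdge {v, w}) → K.IsSimplex T

/-- The link of a simplex `σ`: all `τ` with `σ ∪ τ ∈ K` and `σ ∩ τ = ∅`. -/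
def link [DecidableEq V] (K : PreAbstractSimplicialComplex V) (σ : Finset V) :
    PreAbstractSimplicialComplex V where
  faces := {τ | τ.Nonempty ∧ Disjoint σ τ ∧ σ ∪ τ ∈ K.faces}
  isRelLowerSet_faces := fun _ hτ => ⟨hτ.1, fun _ hρ hne =>
    ⟨hne, Finset.disjoint_of_subset_right hρ hτ.2.1,
      (K.isRelLowerSet_faces hτ.2.2).2 (Finset.union_subset_union_right hρ)
        (hne.mono Finset.subset_union_right)⟩⟩

/-- The join of two complexes, on the disjoint union of their vertex sets. -/
def join (K : PreAbstractSimplicialComplex V) (L : PreAbstractSimplicialComplex W) :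
    PreAbstractSimplicialComplex (V ⊕ W) :=
  ofSimplices (fun ρ => K.IsSimplex ρ.toLeft ∧ L.IsSimplex ρ.toRight) fun _ _ h hτ =>
    ⟨h.1.mono (Finset.toLeft_subset_toLeft hτ), h.2.mono (Finset.toRight_subset_toRight hτ)⟩

/-- The subdivision `Sub_η(K)` of `K` along `η`, with the new vertex `e = none`. Its simplices are
the simplices of `K` that do not contain `η`, and the sets `σ ∪ ζ ∪ {e}` with `σ` in the link of `η`
and `ζ` a proper subset of `η`; if `η = {s, t}` is an edge, `ζ` is one of `∅`, `{s}`, `{t}`. -/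
def subdivide [DecidableEq V] (K : PreAbstractSimplicialComplex V) (η : Finset V) :
    PreAbstractSimplicialComplex (Option V) where
  faces := {ρ | (∃ σ ∈ K.faces, ¬ η ⊆ σ ∧ ρ = σ.map Function.Embedding.some) ∨
    ∃ σ ζ : Finset V, (Disjoint η σ ∧ η ∪ σ ∈ K.faces) ∧ ζ ⊂ η ∧
      ρ = insert none ((σ ∪ ζ).map Function.Embedding.some)}
  isRelLowerSet_faces := by
    have key : ∀ ρ : Finset (Option V), none ∉ ρ →
        ρ = ρ.eraseNone.map Function.Embedding.some := by
      intro ρ h; ext (_ | x) <;> simp [h]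
    have key' : ∀ ρ : Finset (Option V), none ∈ ρ →
        ρ = insert none (ρ.eraseNone.map Function.Embedding.some) := by
      intro ρ h; ext (_ | x) <;> simp [h]
    rintro ρ (⟨σ, hσ, hη, rfl⟩ | ⟨σ, ζ, ⟨hd, hσ⟩, hζ, rfl⟩)
    · refine ⟨(K.isRelLowerSet_faces hσ).1.map, fun τ hτ hne => Or.inl ?_⟩
      obtain ⟨σ', hσ', rfl⟩ := Finset.subset_map_iff.mp hτ
      exact ⟨σ', (K.isRelLowerSet_faces hσ).2 hσ' (by simpa using hne),
        fun h => hη (h.trans hσ'), rfl⟩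
    · have hη : η.Nonempty := let ⟨x, hx, _⟩ := Finset.exists_of_ssubset hζ; ⟨x, hx⟩
      refine ⟨⟨none, by simp⟩, fun τ hτ hne => ?_⟩
      have hsub : τ.eraseNone ⊆ σ ∪ ζ := by
        intro x hx
        have := hτ (Finset.mem_eraseNone.mp hx)
        simpa using this
      by_cases hn : none ∈ τ
      · right
        refine ⟨τ.eraseNone ∩ σ, τ.eraseNone ∩ ζ,
          ⟨Finset.disjoint_of_subset_right Finset.inter_subset_right hd, ?_⟩,
          lt_of_le_of_lt Finset.inter_subset_right hζ, ?_⟩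
        · exact (K.isRelLowerSet_faces hσ).2
            (Finset.union_subset_union_right Finset.inter_subset_right)
            (hη.mono Finset.subset_union_left)
        · rw [← Finset.inter_union_distrib_left, Finset.inter_eq_left.mpr hsub]
          exact key' τ hn
      · left
        refine ⟨τ.eraseNone, (K.isRelLowerSet_faces hσ).2 ?_ ?_, ?_, key τ hn⟩
        · intro x hx
          rcases Finset.mem_union.mp (hsub hx) with h | h
          · exact Finset.mem_union_right _ h
          · exact Finset.mem_union_left _ (hζ.1 h)
        · rw [key τ hn] at hne
          exact Finset.map_nonempty.mp hne
        · intro h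
          obtain ⟨x, hx, hx'⟩ := Finset.exists_of_ssubset hζ
          rcases Finset.mem_union.mp (hsub (h hx)) with h' | h'
          · exact Finset.disjoint_left.mp hd hx h'
          · exact hx' h'

/-- The `m`-gon, for `m ≥ 3`: vertices `0, …, m - 1` in cyclic order and edges `{i, i + 1}`. -/
def polygon (m : ℕ) : PreAbstractSimplicialComplex (ZMod m) :=
  ofSimplices (fun σ => ∃ i, σ ⊆ {i, i + 1}) fun _ _ ⟨i, h⟩ hτ => ⟨i, hτ.trans h⟩

/-- The zero-dimensional sphere: two points and no edge. -/
def zeroSphere : PreAbstractSimplicialComplex Bool :=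
  ofSimplices (fun σ => ∃ b, σ ⊆ {b}) fun _ _ ⟨b, h⟩ hτ => ⟨b, hτ.trans h⟩

/-- The (boundary of the) cross-polytope `O^n`, i.e. the `n`-fold join of the zero-dimensional
sphere: `σ` is a simplex if and only if its part in each of the `n` copies of that sphere is. -/
def crossPolytope (n : ℕ) : PreAbstractSimplicialComplex (Fin n × Bool) :=
  ofSimplices (fun σ => ∀ i, zeroSphere.IsSimplex (Finset.univ.filter fun b => (i, b) ∈ σ))
    fun _ _ h hτ i => (h i).mono (Finset.monotone_filter_right _ fun _ _ hb => hτ hb)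

/-- Isomorphism of complexes: a bijection between the vertex sets under which the faces
correspond. -/
def IsIsomorphic (K : PreAbstractSimplicialComplex V) (L : PreAbstractSimplicialComplex W) :
    Prop :=
  ∃ e : {v // {v} ∈ K.faces} ≃ {w // {w} ∈ L.faces}, ∀ σ : Finset {v // {v} ∈ K.faces},
    σ.map (Function.Embedding.subtype _) ∈ K.faces ↔
      (σ.map e.toEmbedding).map (Function.Embedding.subtype _) ∈ L.faces

open Classical in
/-- The f-polynomial `∑ t ^ #σ`, the sum being over all simplices, the empty one included. -/
noncomputable def fPoly [Fintype V] (K : PreAbstractSimplicialComplex V) : ℤ[X] :=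
  ∑ σ : Finset V with K.IsSimplex σ, X ^ σ.card

open Classical in
/-- The largest number of vertices of a simplex, i.e. the dimension plus one. -/
noncomputable def rank [Fintype V] (K : PreAbstractSimplicialComplex V) : ℕ :=
  (Finset.univ.filter fun σ : Finset V => K.IsSimplex σ).sup Finset.card

open Classical in
/-- The h-polynomial `∑ t ^ #σ * (1 - t) ^ (n - #σ)`, where `n - 1` is the dimension. It is the
polynomial determined by `(1 + t) ^ n * h (1 / (1 + t)) = t ^ n * f (1 / t)`. -/
noncomputable def hPoly [Fintype V] (K : PreAbstractSimplicialComplex V) : ℤ[X] :=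
  ∑ σ : Finset V with K.IsSimplex σ, X ^ σ.card * (1 - X) ^ (K.rank - σ.card)

theorem hPoly_spec [Fintype V] (K : PreAbstractSimplicialComplex V) (t : ℝ) (h0 : t ≠ 0)
    (h1 : 1 + t ≠ 0) :
    (1 + t) ^ K.rank * aeval (1 / (1 + t)) K.hPoly = t ^ K.rank * aeval (1 / t) K.fPoly := by
  classical
  simp only [hPoly, fPoly, map_sum, Finset.mul_sum]
  refine Finset.sum_congr rfl fun σ hσ => ?_
  obtain ⟨k, hk⟩ := Nat.exists_eq_add_of_le (show σ.card ≤ K.rank from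
    Finset.le_sup (f := Finset.card) (by simpa using hσ))
  simp only [map_mul, map_pow, map_sub, map_one, aeval_X]
  rw [show 1 - 1 / (1 + t) = t / (1 + t) by field_simp; ring, hk, Nat.add_sub_cancel_left]
  simp only [div_pow, one_pow, pow_add]
  field_simp

/-- `γ` is the γ-polynomial of `K`: its degree is at most half the degree of the h-polynomial `h`,
and `h(t) = (1 + t) ^ (deg h) * γ(t / (1 + t) ^ 2)`. -/
def IsGammaPoly [Fintype V] (K : PreAbstractSimplicialComplex V) (γ : ℤ[X]) : Prop :=
  2 * γ.natDegree ≤ K.hPoly.natDegree ∧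
  ∀ t : ℝ, 1 + t ≠ 0 →
    aeval t K.hPoly = (1 + t) ^ K.hPoly.natDegree * aeval (t / (1 + t) ^ 2) γ

/-- The h-polynomial has a root in `ℂ` that is not real. -/
def HasNonrealHRoot [Fintype V] (K : PreAbstractSimplicialComplex V) : Prop :=
  ∃ z : ℂ, aeval z K.hPoly = 0 ∧ z.im ≠ 0

/-- The geometric realization of a finite complex, in barycentric coordinates. -/
def realization [Fintype V] (K : PreAbstractSimplicialComplex V) : Set (V → ℝ) :=
  {x | x ∈ stdSimplex ℝ V ∧ ∃ σ ∈ K.faces, ∀ v, v ∉ σ → x v = 0}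

/-- `K` triangulates the `n`-sphere: its realization is homeomorphic to the unit sphere of
`ℝ ^ (n + 1)`. -/
def IsSphereTriangulation [Fintype V] (K : PreAbstractSimplicialComplex V) (n : ℕ) : Prop :=
  Nonempty (K.realization ≃ₜ Metric.sphere (0 : EuclideanSpace ℝ (Fin (n + 1))) 1)

/-- `K` is a convex triangulation of the `n`-sphere: the vertices can be placed in `ℝ ^ (n + 1)` as
the vertices of a full-dimensional convex polytope so that `K` becomes its boundary complex. That
is, all proper faces of the polytope are simplices, and the faces of `K` are exactly the vertex sets
of its nonempty proper faces, i.e. of its intersections with supporting hyperplanes `l = c`. -/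
def IsConvexSphereTriangulation [Fintype V] (K : PreAbstractSimplicialComplex V) (n : ℕ) : Prop :=
  ∃ p : V → EuclideanSpace ℝ (Fin (n + 1)),
    Function.Injective p ∧
    (interior (convexHull ℝ (Set.range p))).Nonempty ∧
    (convexHull ℝ (Set.range p)).extremePoints ℝ = Set.range p ∧
    (∀ σ : Finset V, σ ∈ K.faces ↔ σ.Nonempty ∧ σ ≠ Finset.univ ∧
      ∃ (l : EuclideanSpace ℝ (Fin (n + 1)) →L[ℝ] ℝ) (c : ℝ),
        ∀ v, l (p v) ≤ c ∧ (l (p v) = c ↔ v ∈ σ)) ∧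
    ∀ σ ∈ K.faces, AffineIndependent ℝ fun v : σ => p v

/-- `K` is a convex flag triangulation of the `n`-sphere. -/
def IsConvexFlagSphere [Fintype V] [DecidableEq V] (K : PreAbstractSimplicialComplex V) (n : ℕ) :
    Prop :=
  K.IsFlag ∧ K.IsSphereTriangulation n ∧ K.IsConvexSphereTriangulation n

end PreAbstractSimplicialComplex

/-! Counting. The f-polynomial is multiplicative under joins (`fPoly_join`), and subdividing along
an edge adds `X * (1 + X)` times the f-polynomial of its link (`fPoly_subdivide`); a link isomorphic
to `O^n` contributes `(1 + 2 * X) ^ n` (`IsCross.fPoly`). Put u = X + X². A pentagon has f = 1 + 5u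
and a quadrilateral (1 + 2X)² = 1 + 4u, so the complex X of part (1) has f = ((1 + 5u)² + u(1 +
4u))(1 + 5u) = 1 + 16u + 84u² + 145u³. Each later subdivision adds u(1 + 4u)², which gives 1 + 17u +
92u² + 161u³ and then 1 + 18u + 100u² + 177u³. These cubics have discriminants -23 and -139, hence
non-real roots u. A non-real u forces a non-real X, and the real Möbius map w ↦ w / (1 + w) carries
roots of f to roots of h (`exists_nonreal_root_of_cubic`, `hasNonrealHRoot_of_fPoly`). Since f is
multiplicative, the root survives every join.

Edges. The link of a pair of vertices taken from the two factors of a join is the join of their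
links, the link of a new vertex e is the suspension of the link of the subdivided edge, and the link
of {e, s} is the link of that edge again. These three facts produce all the required edges.

Geometry. `IsRadial` describes a simplicial polytope around the origin by its polar dual: simplices
are the contact sets of functionals bounded by 1 on the vertices. The property passes to joins by
placing the polytopes in complementary subspaces, and to edge subdivisions by adding a vertex
slightly beyond the midpoint of the edge (`IsRadial.exists_subdivide`). It yields convexity
directly, and a sphere by radial projection. Conversely, every convex triangulation is radial after
a translation. For a factor that is merely a topological sphere, the join is treated by extending
homeomorphisms to cones (`IsSphereTriangulation.join`). -/

namespace PreAbstractSimplicialComplex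

/-! ### Simplices and flagness of joins and subdivisions -/

section Basic

variable {V W ι κ : Type*}

theorem isSimplex_empty (K : PreAbstractSimplicialComplex V) : K.IsSimplex ∅ := Or.inl rfl

theorem mem_faces_iff {K : PreAbstractSimplicialComplex V} {σ : Finset V} :
    σ ∈ K.faces ↔ σ.Nonempty ∧ K.IsSimplex σ := by
  constructor
  · exact fun h => ⟨(K.isRelLowerSet_faces h).1, Or.inr h⟩
  · rintro ⟨h, rfl | h'⟩
    · simp at h
    · exact h'

theorem singleton_mem_faces_iff {K : PreAbstractSimplicialComplex V} {v : V} :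
    {v} ∈ K.faces ↔ K.IsSimplex {v} := by
  simp [mem_faces_iff]

theorem isSimplex_ofSimplices {P : Finset V → Prop} {hP : ∀ σ τ, P σ → τ ⊆ σ → P τ}
    {σ : Finset V} : (ofSimplices P hP).IsSimplex σ ↔ σ = ∅ ∨ P σ := by
  by_cases h : σ = ∅
  · simp [h, isSimplex_empty]
  · simp [IsSimplex, ofSimplices, h, Finset.nonempty_iff_ne_empty]

theorem isSimplex_join {K : PreAbstractSimplicialComplex V} {L : PreAbstractSimplicialComplex W}
    {ρ : Finset (V ⊕ W)} :
    (K.join L).IsSimplex ρ ↔ K.IsSimplex ρ.toLeft ∧ L.IsSimplex ρ.toRight := by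
  rw [join, isSimplex_ofSimplices, or_iff_right_iff_imp]
  rintro rfl
  exact ⟨Or.inl rfl, Or.inl rfl⟩

theorem isSimplex_link [DecidableEq V] {K : PreAbstractSimplicialComplex V} {σ τ : Finset V}
    (hσ : σ ∈ K.faces) : (K.link σ).IsSimplex τ ↔ Disjoint σ τ ∧ K.IsSimplex (σ ∪ τ) := by
  have hσ' := mem_faces_iff.mp hσ
  rcases τ.eq_empty_or_nonempty with rfl | h
  · simp [isSimplex_empty, hσ'.2]
  · have h2 : (σ ∪ τ).Nonempty := hσ'.1.mono Finset.subset_union_left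
    have h1 : (K.link σ).IsSimplex τ ↔ τ ∈ (K.link σ).faces := by
      rw [mem_faces_iff]; simp [h]
    rw [h1, ← and_iff_right (a := (σ ∪ τ).Nonempty) (b := K.IsSimplex _) h2, ← mem_faces_iff]
    simp [link, h]

/-- A membership test on the old vertices of `ρ` alone replaces the two-case definition. If the new
vertex lies in `ρ`, the link part and the part inside `η` are recovered as difference and
intersection with `η`. -/
theorem isSimplex_subdivide [DecidableEq V] {K : PreAbstractSimplicialComplex V} {η : Finset V}
    (hη : η.Nonempty) {ρ : Finset (Option V)} :
    (K.subdivide η).IsSimplex ρ ↔ ¬ η ⊆ ρ.eraseNone ∧ K.IsSimplex ρ.eraseNone ∧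
      (none ∈ ρ → K.IsSimplex (ρ.eraseNone ∪ η)) := by
  constructor
  · rintro (rfl | ⟨σ, hσ, h, rfl⟩ | ⟨σ, ζ, ⟨hd, hσ⟩, hζ, rfl⟩)
    · simp [isSimplex_empty, Finset.subset_empty, hη.ne_empty]
    · have : (σ.map Function.Embedding.some).eraseNone = σ := by ext; simp
      rw [this]
      exact ⟨h, Or.inr hσ, by simp⟩
    · have : (insert none ((σ ∪ ζ).map Function.Embedding.some)).eraseNone = σ ∪ ζ := by
        ext; simp
      rw [this]
      refine ⟨fun h => hζ.2 fun x hx => ?_, ?_, fun _ => ?_⟩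
      · rcases Finset.mem_union.mp (h hx) with h' | h'
        · exact absurd h' (Finset.disjoint_left.mp hd hx)
        · exact h'
      · exact IsSimplex.mono (Or.inr hσ)
          (Finset.union_subset Finset.subset_union_right (hζ.1.trans Finset.subset_union_left))
      · exact IsSimplex.mono (Or.inr hσ) (Finset.union_subset
          (Finset.union_subset Finset.subset_union_right (hζ.1.trans Finset.subset_union_left))
          Finset.subset_union_left)
  · rintro ⟨h1, h2, h3⟩
    rcases ρ.eq_empty_or_nonempty with rfl | hne
    · exact isSimplex_empty _
    refine Or.inr ?_
    by_cases hn : none ∈ ρ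
    · refine Or.inr ⟨ρ.eraseNone \ η, ρ.eraseNone ∩ η, ⟨Finset.disjoint_sdiff, ?_⟩, ?_, ?_⟩
      · rw [mem_faces_iff]
        refine ⟨hη.mono Finset.subset_union_left, ?_⟩
        rw [Finset.union_sdiff_self_eq_union, Finset.union_comm]
        exact h3 hn
      · exact Finset.ssubset_iff_subset_ne.mpr ⟨Finset.inter_subset_right, fun h =>
          h1 (Finset.inter_eq_right.mp h)⟩
      · rw [Finset.sdiff_union_inter]
        ext (_ | x) <;> simp [hn]
    · have h : ρ = ρ.eraseNone.map Function.Embedding.some := by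
        ext (_ | x) <;> simp [hn]
      refine Or.inl ⟨ρ.eraseNone, ?_, h1, h⟩
      rw [mem_faces_iff]
      refine ⟨?_, h2⟩
      rw [h] at hne
      exact Finset.map_nonempty.mp hne

theorem isEdge_iff [DecidableEq V] {K : PreAbstractSimplicialComplex V} {η : Finset V} :
    K.IsEdge η ↔ ∃ s t, s ≠ t ∧ η = {s, t} ∧ K.IsSimplex {s, t} := by
  rw [IsEdge, mem_faces_iff, Finset.card_eq_two]
  constructor
  · rintro ⟨⟨-, h⟩, s, t, hst, rfl⟩
    exact ⟨s, t, hst, rfl, h⟩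
  · rintro ⟨s, t, hst, rfl, h⟩
    exact ⟨⟨by simp, h⟩, s, t, hst, rfl⟩

/-! ### Flag complexes -/

/-- Allowing `v = w` merges the vertex condition and the edge condition into one, and for a concrete
complex leaves a statement open to `decide`. -/
theorem isFlag_iff [DecidableEq V] {K : PreAbstractSimplicialComplex V} :
    K.IsFlag ↔ ∀ T : Finset V, (∀ v ∈ T, ∀ w ∈ T, K.IsSimplex {v, w}) → K.IsSimplex T := by
  refine forall_congr' fun T => ⟨fun h h1 => h (fun v hv => ?_) fun v hv w hw hvw => ?_,
    fun h h1 h2 => h fun v hv w hw => ?_⟩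
  · rw [singleton_mem_faces_iff]
    simpa using h1 v hv v hv
  · exact isEdge_iff.mpr ⟨v, w, hvw, rfl, h1 v hv w hw⟩
  · by_cases hvw : v = w
    · subst hvw
      simpa using singleton_mem_faces_iff.mp (h1 v hv)
    · exact Or.inr (h2 v hv w hw hvw).1

theorem IsFlag.join [DecidableEq V] [DecidableEq W] {K : PreAbstractSimplicialComplex V}
    {L : PreAbstractSimplicialComplex W} (hK : K.IsFlag) (hL : L.IsFlag) : (K.join L).IsFlag := by
  rw [isFlag_iff] at *
  intro T hT
  rw [isSimplex_join]
  constructor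
  · refine hK _ fun v hv w hw => ?_
    have := (isSimplex_join.mp (hT _ (Finset.mem_toLeft.mp hv) _ (Finset.mem_toLeft.mp hw))).1
    refine this.mono ?_
    simp [Finset.insert_subset_iff]
  · refine hL _ fun v hv w hw => ?_
    have := (isSimplex_join.mp (hT _ (Finset.mem_toRight.mp hv) _ (Finset.mem_toRight.mp hw))).2
    refine this.mono ?_
    simp [Finset.insert_subset_iff]

/-- A vertex adjacent to the new one is joined in `K` to both ends of `η`. Hence a clique through
the new vertex remains a clique of `K` after adding `η`, and flagness of `K` applies. No clique
contains `η`, which has ceased to be a simplex. -/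
theorem IsFlag.subdivide [DecidableEq V] {K : PreAbstractSimplicialComplex V} (hK : K.IsFlag)
    {η : Finset V} (hη : K.IsEdge η) : (K.subdivide η).IsFlag := by
  obtain ⟨s, t, hst, rfl, he⟩ := isEdge_iff.mp hη
  have hne : ({s, t} : Finset V).Nonempty := by simp
  rw [isFlag_iff] at *
  intro T hT
  rw [isSimplex_subdivide hne]
  have hpair : ∀ v ∈ T.eraseNone, ∀ w ∈ T.eraseNone, K.IsSimplex {v, w} := by
    intro v hv w hw
    have := ((isSimplex_subdivide hne).mp
      (hT _ (Finset.mem_eraseNone.mp hv) _ (Finset.mem_eraseNone.mp hw))).2.1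
    exact this.mono (by simp [Finset.insert_subset_iff])
  refine ⟨fun h => ?_, hK _ hpair, fun hn => hK _ ?_⟩
  · have := ((isSimplex_subdivide hne).mp (hT _ (Finset.mem_eraseNone.mp (h (by simp : s ∈ _))) _
      (Finset.mem_eraseNone.mp (h (by simp : t ∈ _))))).1
    exact this (by simp [Finset.insert_subset_iff])
  · have hmix : ∀ v ∈ T.eraseNone, ∀ w ∈ ({s, t} : Finset V), K.IsSimplex {v, w} := by
      intro v hv w hw
      have := ((isSimplex_subdivide hne).mp (hT _ hn _ (Finset.mem_eraseNone.mp hv))).2.2 (by simp)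
      refine this.mono ?_
      intro x hx
      simp at hx hw ⊢
      grind
    intro v hv w hw
    rcases Finset.mem_union.mp hv with hv' | hv' <;> rcases Finset.mem_union.mp hw with hw' | hw'
    · exact hpair _ hv' _ hw'
    · exact hmix _ hv' _ hw'
    · rw [Finset.pair_comm]; exact hmix _ hw' _ hv'
    · exact he.mono (by intro x hx; simp at *; grind)

theorem isSimplex_polygon {m : ℕ} {σ : Finset (ZMod m)} :
    (polygon m).IsSimplex σ ↔ ∃ i, σ ⊆ {i, i + 1} := by
  rw [polygon, isSimplex_ofSimplices, or_iff_right_iff_imp]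
  rintro rfl
  exact ⟨0, by simp⟩

theorem isSimplex_zeroSphere {σ : Finset Bool} :
    zeroSphere.IsSimplex σ ↔ ¬ (false ∈ σ ∧ true ∈ σ) := by
  rw [zeroSphere, isSimplex_ofSimplices]
  revert σ
  decide

theorem isFlag_polygon_five : (polygon 5).IsFlag := by
  rw [isFlag_iff]
  simp only [isSimplex_polygon]
  decide

theorem isFlag_zeroSphere : zeroSphere.IsFlag := by
  rw [isFlag_iff]
  simp only [isSimplex_zeroSphere]
  decide

end Basic

/-! ### Links that are cross-polytopes -/

section CrossPolytope

variable {V W ι κ : Type*}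

/-- The vertices of `K` are labelled by `φ` in such a way that the simplices are the sets of
vertices containing no antipodal pair `φ (i, false)`, `φ (i, true)`. -/
def IsCross (K : PreAbstractSimplicialComplex V) (φ : ι × Bool → V) : Prop :=
  Function.Injective φ ∧ ∀ σ, K.IsSimplex σ ↔
    (∀ v ∈ σ, v ∈ Set.range φ) ∧ ∀ i, ¬ (φ (i, false) ∈ σ ∧ φ (i, true) ∈ σ)

theorem IsCross.singleton_mem {K : PreAbstractSimplicialComplex V} {φ : ι × Bool → V}
    (h : K.IsCross φ) (v : V) : {v} ∈ K.faces ↔ v ∈ Set.range φ := by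
  rw [singleton_mem_faces_iff, h.2]
  refine ⟨fun h' => h'.1 v (by simp), fun h' => ⟨by simpa using h', fun i hi => ?_⟩⟩
  simp only [Finset.mem_singleton] at hi
  have := h.1 (hi.1.trans hi.2.symm)
  simp at this

theorem IsCross.isSimplex_map {K : PreAbstractSimplicialComplex V} {φ : ι × Bool → V}
    (h : K.IsCross φ) (τ : Finset (ι × Bool)) :
    K.IsSimplex (τ.map ⟨φ, h.1⟩) ↔ ∀ i, ¬ ((i, false) ∈ τ ∧ (i, true) ∈ τ) := by
  rw [h.2]
  have h1 : ∀ x, φ x ∈ τ.map ⟨φ, h.1⟩ ↔ x ∈ τ := fun x => 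
    Finset.mem_map' (⟨φ, h.1⟩ : ι × Bool ↪ V) (a := x) (s := τ)
  simp only [h1, and_iff_right_iff_imp]
  intro _ v hv
  obtain ⟨x, -, rfl⟩ := Finset.mem_map.mp hv
  exact ⟨x, rfl⟩

theorem IsCross.reindex {K : PreAbstractSimplicialComplex V} {φ : ι × Bool → V}
    (h : K.IsCross φ) (e : κ ≃ ι) : K.IsCross fun x : κ × Bool => φ (e x.1, x.2) := by
  refine ⟨fun x y hxy => ?_, fun σ => ?_⟩
  · have := h.1 hxy
    simp only [Prod.mk.injEq, EmbeddingLike.apply_eq_iff_eq] at this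
    exact Prod.ext this.1 this.2
  · rw [h.2]
    have : Set.range (fun x : κ × Bool => φ (e x.1, x.2)) = Set.range φ := by
      ext v
      constructor
      · rintro ⟨x, rfl⟩; exact ⟨_, rfl⟩
      · rintro ⟨⟨i, b⟩, rfl⟩; exact ⟨(e.symm i, b), by simp⟩
    rw [this, e.forall_congr_left]
    simp

theorem IsCross.isIsomorphic {K : PreAbstractSimplicialComplex V}
    {L : PreAbstractSimplicialComplex W} {φ : ι × Bool → V} {ψ : ι × Bool → W}
    (hK : K.IsCross φ) (hL : L.IsCross ψ) : K.IsIsomorphic L := by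
  let e₁ : ι × Bool ≃ {v // {v} ∈ K.faces} := (Equiv.ofInjective φ hK.1).trans
    (Equiv.subtypeEquivRight fun v => (hK.singleton_mem v).symm)
  let e₂ : ι × Bool ≃ {w // {w} ∈ L.faces} := (Equiv.ofInjective ψ hL.1).trans
    (Equiv.subtypeEquivRight fun v => (hL.singleton_mem v).symm)
  refine ⟨e₁.symm.trans e₂, fun σ => ?_⟩
  obtain ⟨τ, rfl⟩ : ∃ τ : Finset (ι × Bool), σ = τ.map e₁.toEmbedding :=
    ⟨σ.map e₁.symm.toEmbedding, by rw [Finset.map_map]; ext; simp⟩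
  have h1 : (τ.map e₁.toEmbedding).map (Function.Embedding.subtype _) = τ.map ⟨φ, hK.1⟩ := by
    rw [Finset.map_map]; rfl
  have h2 : ((τ.map e₁.toEmbedding).map (e₁.symm.trans e₂).toEmbedding).map
      (Function.Embedding.subtype _) = τ.map ⟨ψ, hL.1⟩ := by
    rw [Finset.map_map, Finset.map_map]
    congr 1
    ext x
    change (e₂ (e₁.symm (e₁ x))).1 = _
    rw [e₁.symm_apply_apply]
    rfl
  rw [h1, h2, mem_faces_iff, mem_faces_iff, hK.isSimplex_map, hL.isSimplex_map]
  simp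

/-- The labelling is pulled back along the vertex bijection. This turns an abstract isomorphism
hypothesis on a link into coordinates that can be counted and suspended. -/
theorem IsCross.of_isIsomorphic {K : PreAbstractSimplicialComplex V}
    {L : PreAbstractSimplicialComplex W} {ψ : ι × Bool → W} (hL : L.IsCross ψ)
    (h : K.IsIsomorphic L) : ∃ φ : ι × Bool → V, K.IsCross φ := by
  classical
  obtain ⟨e, he⟩ := h
  have hψ : ∀ x, {ψ x} ∈ L.faces := fun x => (hL.singleton_mem _).mpr ⟨x, rfl⟩
  refine ⟨fun x => (e.symm ⟨ψ x, hψ x⟩).1, fun x y hxy => ?_, fun σ => ?_⟩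
  · have := e.symm.injective (Subtype.ext hxy)
    exact hL.1 (congrArg Subtype.val this)
  · have hr : ∀ v, v ∈ Set.range (fun x => (e.symm ⟨ψ x, hψ x⟩).1) ↔ {v} ∈ K.faces := by
      intro v
      constructor
      · rintro ⟨x, rfl⟩
        exact (e.symm ⟨ψ x, hψ x⟩).2
      · intro hv
        obtain ⟨x, hx⟩ := (hL.singleton_mem _).mp (e ⟨v, hv⟩).2
        refine ⟨x, ?_⟩
        have : (⟨ψ x, hψ x⟩ : {w // {w} ∈ L.faces}) = e ⟨v, hv⟩ := Subtype.ext hx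
        simp [this]
    have hl : K.IsSimplex σ → ∀ v ∈ σ, {v} ∈ K.faces := fun h v hv =>
      singleton_mem_faces_iff.mpr (h.mono (by simpa using hv))
    simp only [hr]
    by_cases hσ : ∀ v ∈ σ, {v} ∈ K.faces
    swap
    · exact ⟨fun h => absurd (hl h) hσ, fun h => absurd h.1 hσ⟩
    rw [and_iff_right hσ]
    obtain ⟨σ, rfl⟩ : ∃ σ' : Finset {v // {v} ∈ K.faces},
        σ = σ'.map (Function.Embedding.subtype _) :=
      ⟨σ.subtype _, (Finset.subtype_map_of_mem hσ).symm⟩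
    have h1 : K.IsSimplex (σ.map (Function.Embedding.subtype _)) ↔
        L.IsSimplex ((σ.map e.toEmbedding).map (Function.Embedding.subtype _)) := by
      rcases σ.eq_empty_or_nonempty with rfl | h
      · simp [isSimplex_empty]
      · have := he σ
        rw [mem_faces_iff, mem_faces_iff] at this
        simpa [h] using this
    have h2 : ∀ x, (e.symm ⟨ψ x, hψ x⟩).1 ∈ σ.map (Function.Embedding.subtype _) ↔
        ψ x ∈ (σ.map e.toEmbedding).map (Function.Embedding.subtype _) := by
      intro x
      constructor
      · intro h
        obtain ⟨y, hy, hy'⟩ := Finset.mem_map.mp h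
        have : y = e.symm ⟨ψ x, hψ x⟩ := Subtype.ext hy'
        subst this
        exact Finset.mem_map.mpr ⟨_, Finset.mem_map.mpr ⟨_, hy, rfl⟩, by simp⟩
      · intro h
        obtain ⟨y, hy, hy'⟩ := Finset.mem_map.mp h
        obtain ⟨z, hz, rfl⟩ := Finset.mem_map.mp hy
        have : e z = ⟨ψ x, hψ x⟩ := Subtype.ext hy'
        rw [← this]
        exact Finset.mem_map.mpr ⟨z, hz, by simp⟩
    rw [h1, hL.2]
    simp only [h2, and_iff_right_iff_imp]
    intro _ w hw
    obtain ⟨y, hy, rfl⟩ := Finset.mem_map.mp hw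
    exact (hL.singleton_mem _).mp y.2

theorem isCross_crossPolytope (n : ℕ) :
    (crossPolytope n).IsCross (id : Fin n × Bool → Fin n × Bool) := by
  refine ⟨Function.injective_id, fun σ => ?_⟩
  rw [crossPolytope, isSimplex_ofSimplices, or_iff_right_iff_imp.mpr]
  · simp [isSimplex_zeroSphere]
  · rintro rfl
    simp [isSimplex_zeroSphere]

theorem exists_isCross_polygon_four : ∃ φ : Fin 2 × Bool → ZMod 4, (polygon 4).IsCross φ := by
  refine ⟨fun x => if x.1 = 0 then (if x.2 then 2 else 0) else (if x.2 then 3 else 1), ?_, ?_⟩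
  · decide
  · simp only [isSimplex_polygon, Set.mem_range]
    decide

theorem isCross_link_polygon_five (x : ZMod 5) : ((polygon 5).link {x}).IsCross
    fun y : Unit × Bool => if y.2 then x + 1 else x - 1 := by
  refine ⟨?_, fun σ => ?_⟩
  · revert x; decide
  · rw [isSimplex_link, isSimplex_polygon]
    · simp only [Set.mem_range]
      revert x σ; decide
    · rw [singleton_mem_faces_iff, isSimplex_polygon]
      exact ⟨x, by simp⟩

/-- The link of a simplex of a join is the join of the two links, and the antipodal pairs of a join
of cross-polytopes are those of both factors. -/
theorem IsCross.link_join [DecidableEq V] [DecidableEq W] {K : PreAbstractSimplicialComplex V}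
    {L : PreAbstractSimplicialComplex W} {σ : Finset V} {τ : Finset W} (hσ : σ ∈ K.faces)
    (hτ : τ ∈ L.faces) {φ : ι × Bool → V} {ψ : κ × Bool → W} (hφ : (K.link σ).IsCross φ)
    (hψ : (L.link τ).IsCross ψ) : ((K.join L).link (σ.disjSum τ)).IsCross
      fun x : (ι ⊕ κ) × Bool => x.1.elim (fun i => .inl (φ (i, x.2))) fun j => .inr (ψ (j, x.2)) := by
  refine ⟨?_, fun ρ => ?_⟩
  · rintro ⟨i | i, b⟩ ⟨j | j, c⟩ h <;> simp at h
    · have := hφ.1 h; simpa using this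
    · have := hψ.1 h; simpa using this
  have h1 : ∀ v, Sum.inl v ∈ Set.range (fun x : (ι ⊕ κ) × Bool =>
      x.1.elim (fun i => (.inl (φ (i, x.2)) : V ⊕ W)) fun j => .inr (ψ (j, x.2))) ↔
      v ∈ Set.range φ := by simp
  have h2 : ∀ v, Sum.inr v ∈ Set.range (fun x : (ι ⊕ κ) × Bool =>
      x.1.elim (fun i => (.inl (φ (i, x.2)) : V ⊕ W)) fun j => .inr (ψ (j, x.2))) ↔
      v ∈ Set.range ψ := by simp
  have h3 : σ.disjSum τ ∈ (K.join L).faces := by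
    rw [mem_faces_iff, isSimplex_join] at *
    refine ⟨?_, by simpa using hσ.2, by simpa using hτ.2⟩
    obtain ⟨x, hx⟩ := hσ.1
    exact ⟨.inl x, by simpa using hx⟩
  have h4 : Disjoint (σ.disjSum τ) ρ ↔ Disjoint σ ρ.toLeft ∧ Disjoint τ ρ.toRight := by
    simp [Finset.disjoint_left]
  have h5 := hφ.2 ρ.toLeft
  have h6 := hψ.2 ρ.toRight
  rw [isSimplex_link hσ] at h5
  rw [isSimplex_link hτ] at h6
  rw [isSimplex_link h3, h4, isSimplex_join, Finset.toLeft_union, Finset.toRight_union,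
    Finset.toLeft_disjSum, Finset.toRight_disjSum, and_and_and_comm, h5, h6]
  simp only [Sum.forall, h1, h2, Finset.mem_toLeft, Finset.mem_toRight, Sum.elim_inl, Sum.elim_inr]
  tauto

/-- The link of the new vertex is the suspension of the link of the edge: `s` and `t` form a new
antipodal pair, indexed by `none`, because `{s, t}` has been removed. -/
theorem IsCross.link_subdivide_none [DecidableEq V] {K : PreAbstractSimplicialComplex V} {s t : V}
    (hst : s ≠ t) (he : K.IsSimplex {s, t}) {φ : ι × Bool → V}
    (hφ : (K.link {s, t}).IsCross φ) : ((K.subdivide {s, t}).link {none}).IsCross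
      fun x : Option ι × Bool =>
        some (x.1.elim (if x.2 then t else s) fun i => φ (i, x.2)) := by
  have hne : ({s, t} : Finset V).Nonempty := by simp
  have hf : {s, t} ∈ K.faces := mem_faces_iff.mpr ⟨hne, he⟩
  have hr : ∀ x, φ x ≠ s ∧ φ x ≠ t := by
    intro x
    have h1 := (hφ.2 {φ x}).mp (singleton_mem_faces_iff.mp ((hφ.singleton_mem _).mpr ⟨x, rfl⟩))
    have h2 := (hφ.2 _).mpr h1
    rw [isSimplex_link hf] at h2
    have := h2.1
    simp at this
    exact this
  have hn : {none} ∈ (K.subdivide {s, t}).faces := by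
    rw [singleton_mem_faces_iff, isSimplex_subdivide hne]
    simpa [isSimplex_empty] using he
  refine ⟨?_, fun ρ => ?_⟩
  · rintro ⟨_ | i, b⟩ ⟨_ | j, c⟩ h
    · revert h; cases b <;> cases c <;> simp [hst, hst.symm]
    · revert h; cases b <;> simp [(hr _).1.symm, (hr _).2.symm]
    · revert h; cases c <;> simp [(hr _).1, (hr _).2]
    · simp at h
      have := hφ.1 h
      simpa using this
  · rw [isSimplex_link hn, isSimplex_subdivide hne]
    have h1 : (({none} : Finset (Option V)) ∪ ρ).eraseNone = ρ.eraseNone := by ext; simp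
    -- Whether `s` or `t` lies in `ρ` is irrelevant here; only the part away from the edge is
    -- constrained by its link.
    have h2 : K.IsSimplex ρ.eraseNone ∧ K.IsSimplex (ρ.eraseNone ∪ {s, t}) ↔
        (K.link {s, t}).IsSimplex (ρ.eraseNone \ {s, t}) := by
      rw [isSimplex_link hf, Finset.union_sdiff_self_eq_union, Finset.union_comm,
        and_iff_right Finset.disjoint_sdiff]
      exact ⟨fun h => h.2, fun h => ⟨h.mono Finset.subset_union_right, h⟩⟩
    have h3 : none ∈ {none} ∪ ρ ↔ True := by simp
    rw [h1, h3, true_imp_iff, h2, hφ.2]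
    have h4 : ∀ v, v ∈ Set.range (fun x : Option ι × Bool =>
        some (x.1.elim (if x.2 then t else s) fun i => φ (i, x.2))) ↔
        v = some s ∨ v = some t ∨ ∃ w ∈ Set.range φ, v = some w := by
      intro v
      constructor
      · rintro ⟨⟨_ | i, b⟩, rfl⟩
        · cases b <;> simp
        · exact .inr (.inr ⟨_, ⟨_, rfl⟩, rfl⟩)
      · rintro (rfl | rfl | ⟨_, ⟨⟨i, b⟩, rfl⟩, rfl⟩)
        · exact ⟨(none, false), by simp⟩
        · exact ⟨(none, true), by simp⟩
        · exact ⟨(some i, b), by simp⟩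
    simp only [h4, Option.forall, Option.elim_none, Option.elim_some, Finset.mem_sdiff,
      Finset.mem_eraseNone, Finset.insert_subset_iff, Finset.singleton_subset_iff,
      Finset.mem_insert, Finset.mem_singleton, Finset.disjoint_singleton_left, hr, or_self,
      not_false_eq_true, and_true, if_true, Bool.false_eq_true, if_false,
      Option.some.injEq, reduceCtorEq, exists_eq_right', and_false]
    grind

/-- Half of a subdivided edge has the same link as the whole edge had, so a subdivision of this type
can be repeated. -/
theorem IsCross.link_subdivide_pair [DecidableEq V] {K : PreAbstractSimplicialComplex V} {s t : V}
    (hst : s ≠ t) (he : K.IsSimplex {s, t}) {φ : ι × Bool → V}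
    (hφ : (K.link {s, t}).IsCross φ) : ((K.subdivide {s, t}).link {none, some s}).IsCross
      fun x : ι × Bool => some (φ x) := by
  have hne : ({s, t} : Finset V).Nonempty := by simp
  have hf : {s, t} ∈ K.faces := mem_faces_iff.mpr ⟨hne, he⟩
  have hn : {none, some s} ∈ (K.subdivide {s, t}).faces := by
    have : (({none, some s}) : Finset (Option V)).eraseNone = {s} := by ext; simp
    rw [mem_faces_iff, isSimplex_subdivide hne, this]
    refine ⟨by simp, ?_, he.mono (by simp), fun _ => by simpa using he⟩
    intro h
    have := h (by simp : t ∈ _)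
    simp at this
    exact hst this.symm
  refine ⟨fun x y h => hφ.1 (by simpa using h), fun ρ => ?_⟩
  rw [isSimplex_link hn, isSimplex_subdivide hne]
  have h1 : (({none, some s} : Finset (Option V)) ∪ ρ).eraseNone = {s} ∪ ρ.eraseNone := by
    ext; simp
  have h2 : Disjoint {none, some s} ρ ∧ ¬ {s, t} ⊆ {s} ∪ ρ.eraseNone ∧
      K.IsSimplex ({s} ∪ ρ.eraseNone) ∧ (none ∈ {none, some s} ∪ ρ →
        K.IsSimplex ({s} ∪ ρ.eraseNone ∪ {s, t})) ↔
      none ∉ ρ ∧ (K.link {s, t}).IsSimplex ρ.eraseNone := by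
    have h3 : {s} ∪ ρ.eraseNone ∪ {s, t} = {s, t} ∪ ρ.eraseNone := by ext; simp
    have h4 : K.IsSimplex ({s, t} ∪ ρ.eraseNone) → K.IsSimplex ({s} ∪ ρ.eraseNone) := fun h =>
      h.mono (Finset.union_subset_union_left (by simp))
    rw [isSimplex_link hf, h3]
    simp only [Finset.disjoint_insert_left, Finset.disjoint_singleton_left, Finset.mem_eraseNone,
      Finset.insert_subset_iff, Finset.singleton_subset_iff, Finset.mem_union,
      Finset.mem_singleton, hst.symm, Finset.mem_insert, true_or, true_and, false_or,
      forall_true_left]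
    tauto
  rw [h1, h2, hφ.2]
  simp only [Option.forall, Finset.mem_eraseNone, Set.mem_range, Option.some.injEq, reduceCtorEq,
    exists_false, imp_false]
  tauto

end CrossPolytope

/-! ### The f-polynomial and non-real roots -/

section Polynomials

variable {V W ι : Type*} [Fintype V] [Fintype W]

open Classical in
theorem fPoly_eq_sum (K : PreAbstractSimplicialComplex V) :
    K.fPoly = ∑ σ : Finset V, if K.IsSimplex σ then X ^ σ.card else 0 := by
  rw [fPoly, Finset.sum_filter]

open Classical in
theorem coeff_fPoly (K : PreAbstractSimplicialComplex V) (k : ℕ) :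
    K.fPoly.coeff k = (Finset.univ.filter fun σ : Finset V => K.IsSimplex σ ∧ σ.card = k).card := by
  rw [fPoly, finsetSum_coeff]
  simp only [coeff_X_pow, Finset.sum_boole, Finset.filter_filter, eq_comm]

theorem rank_eq_natDegree (K : PreAbstractSimplicialComplex V) : K.rank = K.fPoly.natDegree := by
  classical
  apply le_antisymm
  · rw [rank]
    refine Finset.sup_le fun σ hσ => le_natDegree_of_ne_zero ?_
    rw [coeff_fPoly, Nat.cast_ne_zero, ← Nat.pos_iff_ne_zero, Finset.card_pos]
    exact ⟨σ, by simpa using hσ⟩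
  · rw [fPoly]
    refine natDegree_sum_le_of_forall_le _ _ fun σ hσ => ?_
    rw [natDegree_X_pow]
    exact Finset.le_sup (f := Finset.card) hσ

/-- The rank is the degree of the f-polynomial, so the h-polynomial is a function of the
f-polynomial alone and can be computed from it. -/
theorem hPoly_eq_sum_coeff (K : PreAbstractSimplicialComplex V) :
    K.hPoly = ∑ k ∈ Finset.range (K.fPoly.natDegree + 1),
      C (K.fPoly.coeff k) * (X ^ k * (1 - X) ^ (K.fPoly.natDegree - k)) := by
  classical
  rw [hPoly, ← rank_eq_natDegree, ← Finset.sum_fiberwise_of_maps_to (g := Finset.card)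
    (t := Finset.range (K.rank + 1)) fun σ hσ => by
      rw [Finset.mem_range, Nat.lt_succ_iff]; exact Finset.le_sup (f := Finset.card) hσ]
  refine Finset.sum_congr rfl fun k _ => ?_
  rw [coeff_fPoly, Finset.filter_filter, Finset.sum_congr rfl (g := fun _ =>
    X ^ k * (1 - X) ^ (K.rank - k)) fun σ hσ => by rw [(Finset.mem_filter.mp hσ).2.2]]
  simp

/-- The relation between f and h is the substitution w ↦ w / (1 + w), a real Möbius map, which
preserves non-reality. All root arguments can therefore be made with f, the polynomial that behaves
well under joins and subdivisions. -/
theorem hasNonrealHRoot_of_fPoly {K : PreAbstractSimplicialComplex V} {w : ℂ}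
    (hw : aeval w K.fPoly = 0) (him : w.im ≠ 0) : K.HasNonrealHRoot := by
  classical
  have h1 : 1 + w ≠ 0 := fun h => him (by simpa using congrArg Complex.im h)
  refine ⟨w / (1 + w), ?_, ?_⟩
  · have key : (1 + w) ^ K.rank * aeval (w / (1 + w)) K.hPoly = aeval w K.fPoly := by
      simp only [hPoly, fPoly, map_sum, Finset.mul_sum]
      refine Finset.sum_congr rfl fun σ hσ => ?_
      obtain ⟨k, hk⟩ := Nat.exists_eq_add_of_le (show σ.card ≤ K.rank from
        Finset.le_sup (f := Finset.card) (by simpa using hσ))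
      simp only [map_mul, map_pow, map_sub, map_one, aeval_X]
      rw [show 1 - w / (1 + w) = 1 / (1 + w) by field_simp; ring, hk, Nat.add_sub_cancel_left]
      simp only [div_pow, one_pow, pow_add]
      field_simp
    rw [hw] at key
    exact (mul_eq_zero.mp key).resolve_left (pow_ne_zero _ h1)
  · intro h
    apply him
    have h2 : w / (1 + w) = 1 - 1 / (1 + w) := by field_simp; ring
    rw [h2] at h
    have h3 : (1 / (1 + w)).im = 0 := by simpa using h
    have h4 : Complex.normSq (1 + w) ≠ 0 := by simpa [Complex.normSq_eq_zero] using h1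
    rw [one_div, Complex.inv_im] at h3
    rcases div_eq_zero_iff.mp h3 with h | h
    · simpa using h
    · exact absurd h h4

theorem fPoly_join (K : PreAbstractSimplicialComplex V) (L : PreAbstractSimplicialComplex W) :
    (K.join L).fPoly = K.fPoly * L.fPoly := by
  classical
  rw [fPoly_eq_sum, fPoly_eq_sum, fPoly_eq_sum, Finset.sum_mul_sum, ← Finset.sum_product']
  refine Finset.sum_nbij' (fun ρ => (ρ.toLeft, ρ.toRight)) (fun p => p.1.disjSum p.2)
    (by simp) (by simp) (fun ρ _ => by ext (x | x) <;> simp) (by simp) fun ρ _ => ?_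
  have := ρ.card_toLeft_add_card_toRight
  by_cases h1 : K.IsSimplex ρ.toLeft <;> by_cases h2 : L.IsSimplex ρ.toRight <;>
    simp [isSimplex_join, h1, h2, ← pow_add, this]

theorem sum_finset_option {M : Type*} [AddCommMonoid M] (g : Finset (Option V) → M) :
    ∑ ρ, g ρ = ∑ σ : Finset V, (g (σ.map Function.Embedding.some) + g σ.insertNone) := by
  classical
  rw [← Finset.sum_filter_add_sum_filter_not (Finset.univ) (fun ρ : Finset (Option V) => none ∉ ρ),
    Finset.sum_add_distrib]
  congr 1
  · refine Finset.sum_nbij' (fun ρ => ρ.eraseNone) (fun σ => σ.map Function.Embedding.some)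
      (by simp) (by simp) ?_ ?_ ?_
    · intro ρ hρ; ext (_ | x) <;> simp at hρ ⊢; exact hρ
    · intro σ _; ext; simp
    · intro ρ hρ; congr 1; ext (_ | x) <;> simp at hρ ⊢; exact hρ
  · refine Finset.sum_nbij' (fun ρ => ρ.eraseNone) (fun σ => σ.insertNone)
      (by simp) (by simp) ?_ ?_ ?_
    · intro ρ hρ; ext (_ | x) <;> simp at hρ ⊢; exact hρ
    · intro σ _; ext; simp
    · intro ρ hρ; congr 1; ext (_ | x) <;> simp at hρ ⊢; exact hρ

/-- Every set is its part away from `{s, t}` together with one of the four subsets of `{s, t}`. -/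
theorem sum_finset_disjoint_pair [DecidableEq V] {M : Type*} [AddCommMonoid M] {s t : V}
    (hst : s ≠ t) (g : Finset V → M) :
    ∑ σ, g σ = ∑ τ with Disjoint {s, t} τ,
      (g τ + g (insert s τ) + g (insert t τ) + g ({s, t} ∪ τ)) := by
  rw [← Finset.sum_fiberwise_of_maps_to (s := Finset.univ) (g := fun σ => σ \ {s, t})
    (t := Finset.univ.filter fun τ => Disjoint {s, t} τ) fun σ _ => by simp]
  refine Finset.sum_congr rfl fun τ hτ => ?_
  simp only [Finset.mem_filter, Finset.mem_univ, true_and, Finset.disjoint_insert_left,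
    Finset.disjoint_singleton_left] at hτ
  have : (Finset.univ.filter fun σ : Finset V => σ \ {s, t} = τ) =
      {τ, insert s τ, insert t τ, {s, t} ∪ τ} := by
    ext σ
    simp only [Finset.mem_filter, Finset.mem_univ, true_and, Finset.mem_insert,
      Finset.mem_singleton]
    constructor
    · rintro rfl
      by_cases h1 : s ∈ σ <;> by_cases h2 : t ∈ σ
      · right; right; right; ext x; simp; grind
      · right; left; ext x; simp; grind
      · right; right; left; ext x; simp; grind
      · left; ext x; simp; grind
    · rintro (rfl | rfl | rfl | rfl) <;> ext x <;> simp <;> grind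
  rw [this, Finset.sum_insert, Finset.sum_insert, Finset.sum_insert, Finset.sum_singleton]
  · abel
  · intro h
    have := Finset.ext_iff.mp (Finset.mem_singleton.mp h) s
    simp [hst, hτ.1] at this
  · intro h
    simp only [Finset.mem_insert, Finset.mem_singleton] at h
    rcases h with h | h
    · have := Finset.ext_iff.mp h s
      simp [hst, hτ.1] at this
    · have := Finset.ext_iff.mp h t
      simp [hst.symm, hτ.2] at this
  · intro h
    simp only [Finset.mem_insert, Finset.mem_singleton] at h
    rcases h with h | h | h
    · have := Finset.ext_iff.mp h s
      simp [hτ.1] at this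
    · have := Finset.ext_iff.mp h t
      simp [hτ.2] at this
    · have := Finset.ext_iff.mp h t
      simp [hτ.2] at this

/-- Fix `τ` disjoint from the edge, with `k` vertices. If `{s, t} ∪ τ` is a simplex, subdividing
deletes it and creates `τ` with e, with e and `s`, and with e and `t`: the net gain is X^(k+1) +
2X^(k+2) - X^(k+2) = X(1 + X)X^k. Otherwise nothing changes. -/
theorem fPoly_subdivide [DecidableEq V] {K : PreAbstractSimplicialComplex V} {η : Finset V}
    (hη : K.IsEdge η) :
    (K.subdivide η).fPoly = K.fPoly + X * (1 + X) * (K.link η).fPoly := by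
  classical
  obtain ⟨s, t, hst, rfl, he⟩ := isEdge_iff.mp hη
  rw [fPoly_eq_sum, fPoly_eq_sum, fPoly_eq_sum, sum_finset_option, sum_finset_disjoint_pair hst,
    sum_finset_disjoint_pair hst, Finset.mul_sum]
  simp only [isSimplex_link hη.1]
  rw [show (∑ σ : Finset V, X * (1 + X) *
      (if Disjoint {s, t} σ ∧ K.IsSimplex ({s, t} ∪ σ) then (X : ℤ[X]) ^ σ.card else 0)) =
      ∑ σ with Disjoint {s, t} σ, X * (1 + X) *
        (if K.IsSimplex ({s, t} ∪ σ) then (X : ℤ[X]) ^ σ.card else 0) by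
    rw [Finset.sum_filter]
    refine Finset.sum_congr rfl fun σ _ => ?_
    by_cases h : Disjoint {s, t} σ <;> simp only [h, true_and, false_and, if_true, if_false,
      mul_zero], ← Finset.sum_add_distrib]
  refine Finset.sum_congr rfl fun τ hτ => ?_
  simp only [Finset.mem_filter, Finset.mem_univ, true_and, Finset.disjoint_insert_left,
    Finset.disjoint_singleton_left] at hτ
  have hne : ({s, t} : Finset V).Nonempty := by simp
  have e1 : ∀ σ : Finset V, (σ.map Function.Embedding.some).eraseNone = σ := by intro; ext; simp
  have e2 : ∀ σ : Finset V, σ.insertNone.eraseNone = σ := by intro; ext; simp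
  have e3 : insert s τ ∪ {s, t} = {s, t} ∪ τ := by ext; simp
  have e4 : insert t τ ∪ {s, t} = {s, t} ∪ τ := by ext; simp
  have e5 : τ ∪ {s, t} = {s, t} ∪ τ := Finset.union_comm _ _
  have n1 : ¬ {s, t} ⊆ τ := fun h => hτ.1 (h (by simp))
  have n2 : ¬ {s, t} ⊆ insert s τ := fun h => by simpa [hst.symm, hτ.2] using h (by simp : t ∈ _)
  have n3 : ¬ {s, t} ⊆ insert t τ := fun h => by simpa [hst, hτ.1] using h (by simp : s ∈ _)
  have c1 : (insert s τ).card = τ.card + 1 := Finset.card_insert_of_notMem hτ.1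
  have c2 : (insert t τ).card = τ.card + 1 := Finset.card_insert_of_notMem hτ.2
  have c3 : ({s, t} ∪ τ).card = τ.card + 2 := by
    rw [Finset.card_union_of_disjoint (by simpa using hτ), Finset.card_pair hst, add_comm]
  have m1 : ∀ σ : Finset V, none ∉ σ.map Function.Embedding.some := by simp
  have m2 : ∀ σ : Finset V, none ∈ σ.insertNone := by simp
  simp only [isSimplex_subdivide hne, e1, e2, e3, e4, e5, n1, n2, n3, m1, m2, false_imp_iff,
    not_false_eq_true, true_and, and_true, true_imp_iff, Finset.card_map, Finset.card_insertNone,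
    c1, c2, c3, Finset.subset_union_left, not_true_eq_false, false_and, if_false]
  have i1 : K.IsSimplex ({s, t} ∪ τ) → K.IsSimplex τ := fun h =>
    h.mono Finset.subset_union_right
  have i2 : K.IsSimplex ({s, t} ∪ τ) → K.IsSimplex (insert s τ) := fun h =>
    h.mono (by intro x; simp; tauto)
  have i3 : K.IsSimplex ({s, t} ∪ τ) → K.IsSimplex (insert t τ) := fun h =>
    h.mono (by intro x; simp; tauto)
  by_cases h : K.IsSimplex ({s, t} ∪ τ)
  · simp only [h, i1 h, i2 h, i3 h, and_self, if_true]
    ring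
  · simp only [h, and_false, if_false]
    ring

/-- From each antipodal pair a simplex takes nothing or one of two points, independently, so each
pair contributes a factor `1 + 2 * X`. -/
theorem IsCross.fPoly [Fintype ι] {K : PreAbstractSimplicialComplex V} {φ : ι × Bool → V}
    (h : K.IsCross φ) : K.fPoly = (1 + 2 * X) ^ Fintype.card ι := by
  classical
  have h1 : ∀ i : ι, (∑ s ∈ ({∅, {false}, {true}} : Finset (Finset Bool)), (X : ℤ[X]) ^ s.card) =
      1 + 2 * X := by
    intro i
    rw [Finset.sum_insert (by decide), Finset.sum_insert (by decide), Finset.sum_singleton]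
    simp
    ring
  rw [PreAbstractSimplicialComplex.fPoly, ← Finset.card_univ, ← Finset.prod_const,
    Finset.prod_congr rfl (fun i _ => (h1 i).symm), Finset.prod_univ_sum]
  let F : (ι → Finset Bool) → Finset (ι × Bool) := fun f => Finset.univ.filter fun x => x.2 ∈ f x.1
  let G : Finset V → ι → Finset Bool := fun σ i => Finset.univ.filter fun b => φ (i, b) ∈ σ
  have hF : ∀ f i b, φ (i, b) ∈ (F f).map ⟨φ, h.1⟩ ↔ b ∈ f i := by
    intro f i b
    rw [show φ (i, b) = (⟨φ, h.1⟩ : ι × Bool ↪ V) (i, b) from rfl, Finset.mem_map']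
    simp [F]
  have hB : ∀ s : Finset Bool, s ∈ ({∅, {false}, {true}} : Finset (Finset Bool)) ↔
      ¬ (false ∈ s ∧ true ∈ s) := by decide
  refine Finset.sum_nbij' G (fun f => (F f).map ⟨φ, h.1⟩) ?_ ?_ ?_ ?_ ?_
  · intro σ hσ
    simp only [Finset.mem_filter, Finset.mem_univ, true_and, h.2] at hσ
    rw [Fintype.mem_piFinset]
    intro i
    rw [hB]
    simpa [G] using hσ.2 i
  · intro f hf
    simp only [Fintype.mem_piFinset, hB] at hf
    simp only [Finset.mem_filter, Finset.mem_univ, true_and, h.isSimplex_map]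
    simpa [F] using hf
  · intro σ hσ
    simp only [Finset.mem_filter, Finset.mem_univ, true_and, h.2] at hσ
    ext v
    constructor
    · intro hv
      obtain ⟨⟨i, b⟩, hx, rfl⟩ := Finset.mem_map.mp hv
      simpa [F, G] using hx
    · intro hv
      obtain ⟨⟨i, b⟩, rfl⟩ := hσ.1 v hv
      rw [hF]
      simpa [G] using hv
  · intro f _
    ext i b
    simp only [G, Finset.mem_filter, Finset.mem_univ, true_and, hF]
  · intro σ hσ
    simp only [Finset.mem_filter, Finset.mem_univ, true_and, h.2] at hσ
    rw [Finset.prod_pow_eq_pow_sum]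
    congr 1
    have : σ = (Finset.univ.sigma (G σ)).map ⟨fun x => φ (x.1, x.2), fun x y hxy => by
        have := h.1 hxy
        simp only [Prod.mk.injEq] at this
        exact Sigma.ext this.1 (heq_of_eq this.2)⟩ := by
      ext v
      constructor
      · intro hv
        obtain ⟨⟨i, b⟩, rfl⟩ := hσ.1 v hv
        exact Finset.mem_map.mpr ⟨⟨i, b⟩, by simpa [G] using hv, rfl⟩
      · intro hv
        obtain ⟨⟨i, b⟩, hx, rfl⟩ := Finset.mem_map.mp hv
        change φ (i, b) ∈ σ
        simpa [G] using hx
    conv_lhs => rw [this]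
    rw [Finset.card_map, Finset.card_sigma]

theorem fPoly_polygon_five : (polygon 5).fPoly = 1 + 5 * X + 5 * X ^ 2 := by
  classical
  have h : ∀ k, (polygon 5).fPoly.coeff k = ((Finset.univ.filter fun σ : Finset (ZMod 5) =>
      (∃ i, σ ⊆ {i, i + 1}) ∧ σ.card = k).card : ℤ) := by
    intro k
    rw [coeff_fPoly]
    congr 2
    ext σ
    simp [isSimplex_polygon]
  have hd : (polygon 5).fPoly.natDegree < 3 := by
    rw [← rank_eq_natDegree, rank, Finset.sup_lt_iff (by norm_num)]
    intro σ hσ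
    rw [Finset.mem_filter, isSimplex_polygon] at hσ
    obtain ⟨i, hi⟩ := hσ.2
    exact lt_of_le_of_lt (Finset.card_le_card hi) (lt_of_le_of_lt Finset.card_le_two (by norm_num))
  rw [(polygon 5).fPoly.as_sum_range' 3 hd]
  simp only [Finset.sum_range_succ, Finset.sum_range_zero, h]
  rw [show (Finset.univ.filter fun σ : Finset (ZMod 5) =>
      (∃ i, σ ⊆ {i, i + 1}) ∧ σ.card = 0).card = 1 by decide,
    show (Finset.univ.filter fun σ : Finset (ZMod 5) =>
      (∃ i, σ ⊆ {i, i + 1}) ∧ σ.card = 1).card = 5 by decide,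
    show (Finset.univ.filter fun σ : Finset (ZMod 5) =>
      (∃ i, σ ⊆ {i, i + 1}) ∧ σ.card = 2).card = 5 by decide]
  simp [← C_mul_X_pow_eq_monomial]

/-- If all three roots were real, the discriminant, on the left of `hd`, would be the square of a
real number. -/
theorem exists_nonreal_root_cubic (a b c : ℝ) (ha : a ≠ 0)
    (hd : 18 * a * b * c - 4 * b ^ 3 + b ^ 2 * c ^ 2 - 4 * a * c ^ 3 - 27 * a ^ 2 < 0) :
    ∃ u : ℂ, 1 + c * u + b * u ^ 2 + a * u ^ 3 = 0 ∧ u.im ≠ 0 := by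
  by_contra! hcon
  have ha' : (a : ℂ) ≠ 0 := by exact_mod_cast ha
  let P : Cubic ℂ := ⟨a, b, c, 1⟩
  have hs : P.toPoly.Splits := IsAlgClosed.splits _
  obtain ⟨x, y, z, h⟩ := (Cubic.splits_iff_roots_eq_three (φ := RingHom.id ℂ) (P := P) ha').mp
    (by simpa [Cubic.map] using hs)
  have hroot : ∀ u ∈ ({x, y, z} : Multiset ℂ), ∃ r : ℝ, u = r := by
    intro u hu
    rw [← h] at hu
    have h0 : P.toPoly.eval u = 0 := by
      have := hu
      simp only [Cubic.map, RingHom.id_apply] at this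
      exact (Polynomial.mem_roots'.mp this).2
    have h1 : (1 : ℂ) + c * u + b * u ^ 2 + a * u ^ 3 = 0 := by
      rw [← h0]
      simp [P, Cubic.toPoly]
      ring
    exact ⟨u.re, Complex.ext rfl (by simpa using hcon u h1)⟩
  obtain ⟨x', hx⟩ := hroot x (by simp)
  obtain ⟨y', hy⟩ := hroot y (by simp)
  obtain ⟨z', hz⟩ := hroot z (by simp)
  subst hx hy hz
  have hdisc := Cubic.discr_eq_prod_three_roots (φ := RingHom.id ℂ) (P := P) ha' h
  simp only [RingHom.id_apply, Cubic.discr, P] at hdisc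
  have h2 : b ^ 2 * c ^ 2 - 4 * a * c ^ 3 - 4 * b ^ 3 * 1 - 27 * a ^ 2 * 1 ^ 2 +
      18 * a * b * c * 1 = (a * a * (x' - y') * (x' - z') * (y' - z')) ^ 2 := by
    exact_mod_cast hdisc
  nlinarith [sq_nonneg (a * a * (x' - y') * (x' - z') * (y' - z'))]

/-- The cubic in u = X + X² has a non-real root u, and any w with w + w² = u is non-real, since a
real w would make u real. -/
theorem exists_nonreal_root_of_cubic {f : ℤ[X]} (a b c : ℤ) (ha : a ≠ 0)
    (hd : 18 * a * b * c - 4 * b ^ 3 + b ^ 2 * c ^ 2 - 4 * a * c ^ 3 - 27 * a ^ 2 < 0)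
    (hf : f = 1 + C c * (X + X ^ 2) + C b * (X + X ^ 2) ^ 2 + C a * (X + X ^ 2) ^ 3) :
    ∃ w : ℂ, aeval w f = 0 ∧ w.im ≠ 0 := by
  obtain ⟨u, hu, him⟩ := exists_nonreal_root_cubic a b c (by exact_mod_cast ha)
    (by exact_mod_cast hd)
  -- Quadratic formula for w² + w = u, whose discriminant is 1 + 4u.
  obtain ⟨r, hr⟩ := IsAlgClosed.exists_pow_nat_eq (1 + 4 * u) (n := 2) (by norm_num)
  have hw : (r - 1) / 2 + ((r - 1) / 2) ^ 2 = u := by linear_combination hr / 4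
  refine ⟨(r - 1) / 2, ?_, fun h => him ?_⟩
  · rw [hf]
    simp only [map_add, map_mul, map_pow, map_one, aeval_X, aeval_C, hw]
    simpa using hu
  · rw [← hw]
    simp [pow_two, h]

end Polynomials

/-! ### Polytopes around the origin, described by functionals -/

section Radial

variable {V W E F : Type*} [NormedAddCommGroup E] [NormedSpace ℝ E] [NormedAddCommGroup F]
  [NormedSpace ℝ F]

/-- The points `p v` are the vertices of a simplicial polytope that has the origin in its interior
and `K` as its boundary complex; everything is expressed by linear functionals. -/
structure IsRadial (K : PreAbstractSimplicialComplex V) (p : V → E) : Prop where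
  -- This says that the origin is interior to the convex hull.
  eq_zero : ∀ l : E →L[ℝ] ℝ, (∀ v, l (p v) ≤ 0) → l = 0
  vertex : ∀ v, K.IsSimplex {v}
  isSimplex_iff : ∀ σ : Finset V, K.IsSimplex σ ↔
    ∃ l : E →L[ℝ] ℝ, ∀ v, l (p v) ≤ 1 ∧ (l (p v) = 1 ↔ v ∈ σ)
  -- The dual form of linear independence of the vertices of a simplex, easier to transport than
  -- independence itself.
  prescribe : ∀ σ : Finset V, K.IsSimplex σ → ∀ g : V → ℝ,
    ∃ l : E →L[ℝ] ℝ, ∀ v ∈ σ, l (p v) = g v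

theorem IsRadial.map {K : PreAbstractSimplicialComplex V} {p : V → E} (h : K.IsRadial p)
    (e : E ≃L[ℝ] F) : K.IsRadial fun v => e (p v) where
  eq_zero l hl := by
    have := h.eq_zero (l.comp (e : E →L[ℝ] F)) hl
    ext y
    simpa using congrArg (fun l => l (e.symm y)) this
  vertex := h.vertex
  isSimplex_iff σ := by
    rw [h.isSimplex_iff]
    constructor
    · rintro ⟨l, hl⟩
      exact ⟨l.comp (e.symm : F →L[ℝ] E), by simpa using hl⟩
    · rintro ⟨l, hl⟩
      exact ⟨l.comp (e : E →L[ℝ] F), by simpa using hl⟩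
  prescribe σ hσ g := by
    obtain ⟨l, hl⟩ := h.prescribe σ hσ g
    exact ⟨l.comp (e.symm : F →L[ℝ] E), by simpa using hl⟩

/-- The two polytopes lie in complementary subspaces. A functional on the product is an arbitrary
pair of functionals, and the conditions on the two vertex sets decouple. -/
theorem IsRadial.join {K : PreAbstractSimplicialComplex V} {L : PreAbstractSimplicialComplex W}
    {p : V → E} {q : W → F} (hK : K.IsRadial p) (hL : L.IsRadial q) :
    (K.join L).IsRadial (E := E × F) (Sum.elim (fun v => (p v, 0)) fun w => (0, q w)) where
  eq_zero l hl := by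
    have h1 := hK.eq_zero (l.comp (.inl ℝ E F)) fun v => hl (.inl v)
    have h2 := hL.eq_zero (l.comp (.inr ℝ E F)) fun w => hl (.inr w)
    ext x
    · exact congrArg (fun l => l x) h1
    · exact congrArg (fun l => l x) h2
  vertex := by
    classical
    rintro (v | w)
    · rw [isSimplex_join]
      exact ⟨(hK.vertex v).mono fun x hx => by simpa using hx,
        (isSimplex_empty L).mono fun x hx => by simp at hx⟩
    · rw [isSimplex_join]
      exact ⟨(isSimplex_empty K).mono fun x hx => by simp at hx,
        (hL.vertex w).mono fun x hx => by simpa using hx⟩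
  isSimplex_iff σ := by
    rw [isSimplex_join, hK.isSimplex_iff, hL.isSimplex_iff]
    constructor
    · rintro ⟨⟨l, hl⟩, m, hm⟩
      refine ⟨l.coprod m, ?_⟩
      rintro (v | w)
      · simpa using hl v
      · simpa using hm w
    · rintro ⟨l, hl⟩
      exact ⟨⟨l.comp (.inl ℝ E F), fun v => by simpa using hl (.inl v)⟩,
        l.comp (.inr ℝ E F), fun w => by simpa using hl (.inr w)⟩
  prescribe σ hσ g := by
    rw [isSimplex_join] at hσ
    obtain ⟨l, hl⟩ := hK.prescribe _ hσ.1 fun v => g (.inl v)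
    obtain ⟨m, hm⟩ := hL.prescribe _ hσ.2 fun v => g (.inr v)
    refine ⟨l.coprod m, ?_⟩
    rintro (v | w) h
    · simpa using hl v (by simpa using h)
    · simpa using hm w (by simpa using h)

theorem isRadial_zeroSphere : zeroSphere.IsRadial fun b : Bool => if b then (1 : ℝ) else -1 where
  eq_zero l hl := by
    have h1 := hl true
    have h2 := hl false
    simp only [if_true, Bool.false_eq_true, if_false, map_neg] at h1 h2
    ext
    simp
    linarith
  vertex v := by rw [isSimplex_zeroSphere]; cases v <;> simp
  isSimplex_iff σ := by
    rw [isSimplex_zeroSphere]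
    constructor
    · intro h
      refine ⟨(if true ∈ σ then 1 else if false ∈ σ then -1 else 0 : ℝ) •
        ContinuousLinearMap.id ℝ ℝ, ?_⟩
      by_cases h1 : true ∈ σ <;> by_cases h2 : false ∈ σ
      · exact absurd ⟨h2, h1⟩ h
      all_goals simp [h1, h2] <;> norm_num
    · rintro ⟨l, hl⟩ ⟨h1, h2⟩
      have h1 := (hl false).2.mpr h1
      have h2 := (hl true).2.mpr h2
      simp only [if_true, Bool.false_eq_true, if_false, map_neg] at h1 h2
      linarith
  prescribe σ hσ g := by
    rw [isSimplex_zeroSphere] at hσ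
    by_cases h : true ∈ σ
    · refine ⟨g true • ContinuousLinearMap.id ℝ ℝ, ?_⟩
      rintro (_ | _) h1
      · exact absurd ⟨h1, h⟩ hσ
      · simp
    · refine ⟨(-g false) • ContinuousLinearMap.id ℝ ℝ, ?_⟩
      rintro (_ | _) h1
      · simp
      · exact absurd h1 h

/-- The abscissas of the vertices of a lattice pentagon. -/
def pentagonX : ZMod 5 → ℤ := (![1, 1, 0, -1, 0] : Fin 5 → ℤ)

/-- The ordinates of the vertices of a lattice pentagon. -/
def pentagonY : ZMod 5 → ℤ := (![0, 1, 1, 0, -1] : Fin 5 → ℤ)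

theorem apply_pentagon (l : ℝ × ℝ →L[ℝ] ℝ) (v : ZMod 5) :
    l ((pentagonX v : ℝ), (pentagonY v : ℝ)) =
      pentagonX v * l (1, 0) + pentagonY v * l (0, 1) := by
  rw [← smul_eq_mul, ← smul_eq_mul, ← map_smul, ← map_smul, ← map_add]
  simp

theorem isRadial_pentagon :
    (polygon 5).IsRadial fun v => ((pentagonX v : ℝ), (pentagonY v : ℝ)) where
  eq_zero l hl := by
    simp only [apply_pentagon] at hl
    have h0 := hl 0
    have h2 := hl 2
    have h3 := hl 3
    have h4 := hl 4
    rw [show pentagonX 0 = 1 from rfl, show pentagonY 0 = 0 from rfl] at h0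
    rw [show pentagonX 2 = 0 from rfl, show pentagonY 2 = 1 from rfl] at h2
    rw [show pentagonX 3 = -1 from rfl, show pentagonY 3 = 0 from rfl] at h3
    rw [show pentagonX 4 = 0 from rfl, show pentagonY 4 = -1 from rfl] at h4
    push_cast at h0 h2 h3 h4
    ext
    · simp; linarith
    · simp; linarith
  vertex v := isSimplex_polygon.mpr ⟨v, by simp⟩
  isSimplex_iff σ := by
    rw [isSimplex_polygon]
    constructor
    -- Doubling clears denominators: every face of the lattice pentagon is cut out by a functional
    -- with half-integral coefficients of absolute value at most 1.
    · have key : ∀ σ : Finset (ZMod 5), (∃ i, σ ⊆ {i, i + 1}) →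
          ∃ a ∈ ({-2, -1, 0, 1, 2} : Finset ℤ), ∃ b ∈ ({-2, -1, 0, 1, 2} : Finset ℤ), ∀ v,
            a * pentagonX v + b * pentagonY v ≤ 2 ∧
              (a * pentagonX v + b * pentagonY v = 2 ↔ v ∈ σ) := by decide
      intro hσ
      obtain ⟨a, -, b, -, hab⟩ := key σ hσ
      refine ⟨((a : ℝ) / 2) • ContinuousLinearMap.fst ℝ ℝ ℝ +
        ((b : ℝ) / 2) • ContinuousLinearMap.snd ℝ ℝ ℝ, fun v => ?_⟩
      have h1 : (a : ℝ) * pentagonX v + b * pentagonY v ≤ 2 := by exact_mod_cast (hab v).1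
      have h2 : (a : ℝ) * pentagonX v + b * pentagonY v = 2 ↔ v ∈ σ := by
        rw [← (hab v).2]; exact_mod_cast Iff.rfl
      simp only [add_apply, smul_apply, smul_eq_mul,
        ContinuousLinearMap.coe_fst', ContinuousLinearMap.coe_snd']
      rw [← h2]
      exact ⟨by linarith, fun h => by linarith, fun h => by linarith⟩
    · rintro ⟨l, hl⟩
      -- A non-simplex contains two vertices at distance two. By `key'` they add up to the vertex
      -- between them or to the origin, so value 1 at both would force value 2 at the middle vertex,
      -- or 0 = 2.
      have key : ∀ σ : Finset (ZMod 5), (¬ ∃ i, σ ⊆ {i, i + 1}) → ∃ i, i ∈ σ ∧ i + 2 ∈ σ := by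
        decide
      have key' : ∀ i, (pentagonX i + pentagonX (i + 2) = pentagonX (i + 1) ∧
          pentagonY i + pentagonY (i + 2) = pentagonY (i + 1)) ∨
          (pentagonX i + pentagonX (i + 2) = 0 ∧ pentagonY i + pentagonY (i + 2) = 0) := by decide
      by_contra hσ
      obtain ⟨i, h1, h2⟩ := key σ hσ
      have h1 := (hl i).2.mpr h1
      have h2 := (hl (i + 2)).2.mpr h2
      have h3 := (hl (i + 1)).1
      rw [apply_pentagon] at h1 h2 h3
      rcases key' i with ⟨hx, hy⟩ | ⟨hx, hy⟩
      · rw [← hx, ← hy] at h3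
        push_cast at h3
        linarith
      · have hx : (pentagonX i : ℝ) + pentagonX (i + 2) = 0 := by exact_mod_cast hx
        have hy : (pentagonY i : ℝ) + pentagonY (i + 2) = 0 := by exact_mod_cast hy
        have : (0 : ℝ) = 2 := by linear_combination h1 + h2 - l (1, 0) * hx - l (0, 1) * hy
        norm_num at this
  prescribe σ hσ g := by
    obtain ⟨i, hi⟩ := isSimplex_polygon.mp hσ
    -- Consecutive vertices form a unimodular basis, so Cramer's rule below needs no division.
    have key : ∀ i, pentagonX i * pentagonY (i + 1) - pentagonX (i + 1) * pentagonY i = 1 := by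
      decide
    have hdet : (pentagonX i : ℝ) * pentagonY (i + 1) - pentagonX (i + 1) * pentagonY i = 1 := by
      exact_mod_cast key i
    refine ⟨(g i * pentagonY (i + 1) - g (i + 1) * pentagonY i) • ContinuousLinearMap.fst ℝ ℝ ℝ +
      (g (i + 1) * pentagonX i - g i * pentagonX (i + 1)) • ContinuousLinearMap.snd ℝ ℝ ℝ,
      fun v hv => ?_⟩
    simp only [add_apply, smul_apply, smul_eq_mul,
      ContinuousLinearMap.coe_fst', ContinuousLinearMap.coe_snd']
    have := hi hv
    simp only [Finset.mem_insert, Finset.mem_singleton] at this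
    rcases this with rfl | rfl
    · linear_combination g v * hdet
    · linear_combination g (i + 1) * hdet

/-- Quantitative form of `eq_zero`: the maximum over the vertices is continuous and positive on the
compact unit sphere of the dual, and homogeneity extends the bound to all functionals. -/
theorem IsRadial.exists_lower_bound [Fintype V] [Nonempty V] [FiniteDimensional ℝ E]
    {K : PreAbstractSimplicialComplex V} {p : V → E} (h : K.IsRadial p) :
    ∃ r > 0, ∀ l : E →L[ℝ] ℝ, ∃ v, r * ‖l‖ ≤ l (p v) := by
  let g : (E →L[ℝ] ℝ) → ℝ := fun l =>
    Finset.univ.sup' Finset.univ_nonempty fun v : V => l (p v)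
  have hg : Continuous g := by
    apply Continuous.finset_sup'_apply
    intro v _
    fun_prop
  have hcomp : IsCompact (Metric.sphere (0 : E →L[ℝ] ℝ) 1) := isCompact_sphere _ _
  rcases (Metric.sphere (0 : E →L[ℝ] ℝ) 1).eq_empty_or_nonempty with he | hne
  · refine ⟨1, one_pos, fun l => ?_⟩
    have : l = 0 := by
      by_contra hl
      have : (‖l‖⁻¹ • l) ∈ Metric.sphere (0 : E →L[ℝ] ℝ) 1 := by
        simp [norm_smul, hl]
      rw [he] at this
      exact this
    exact ⟨Classical.arbitrary V, by simp [this]⟩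
  · obtain ⟨l₀, hl₀, hmin⟩ := hcomp.exists_isMinOn hne hg.continuousOn
    refine ⟨g l₀, ?_, fun l => ?_⟩
    · by_contra hle
      have : l₀ = 0 := h.eq_zero l₀ fun v =>
        (Finset.le_sup' (fun v : V => l₀ (p v)) (Finset.mem_univ v)).trans (not_lt.mp hle)
      simp [this] at hl₀
    · by_cases hl : l = 0
      · exact ⟨Classical.arbitrary V, by simp [hl]⟩
      · have hl' : 0 < ‖l‖ := norm_pos_iff.mpr hl
        have h1 : (‖l‖⁻¹ • l) ∈ Metric.sphere (0 : E →L[ℝ] ℝ) 1 := by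
          simp [norm_smul, hl]
        have h2 : g l₀ ≤ g (‖l‖⁻¹ • l) := hmin h1
        obtain ⟨v, -, hv⟩ := Finset.exists_mem_eq_sup' Finset.univ_nonempty
          fun v : V => (‖l‖⁻¹ • l) (p v)
        refine ⟨v, ?_⟩
        have h3 : g (‖l‖⁻¹ • l) = ‖l‖⁻¹ * l (p v) := hv
        rw [h3, inv_mul_eq_div, le_div_iff₀ hl'] at h2
        exact h2

/-- The set is the part of the polar body where the constraints from `σ` are tight; the lower bound
makes it bounded. -/
theorem IsRadial.isCompact_polar [Fintype V] [Nonempty V] [FiniteDimensional ℝ E]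
    {K : PreAbstractSimplicialComplex V} {p : V → E} (h : K.IsRadial p) (σ : Finset V) :
    IsCompact {l : E →L[ℝ] ℝ | (∀ v, l (p v) ≤ 1) ∧ ∀ v ∈ σ, l (p v) = 1} := by
  obtain ⟨r, hr, hl⟩ := h.exists_lower_bound
  refine Metric.isCompact_of_isClosed_isBounded ?_ ?_
  · refine IsClosed.and ?_ ?_
    · simp only [Set.ofPred_forall]
      exact isClosed_iInter fun v => isClosed_le (by fun_prop) (by fun_prop)
    · simp only [Set.ofPred_forall]
      exact isClosed_iInter fun v => isClosed_iInter fun _ => isClosed_eq (by fun_prop) (by fun_prop)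
  · refine (Metric.isBounded_closedBall (x := (0 : E →L[ℝ] ℝ)) (r := 1 / r)).subset fun l h => ?_
    obtain ⟨v, hv⟩ := hl l
    rw [mem_closedBall_zero_iff, le_div_iff₀ hr]
    linarith [h.1 v]

-- The new vertex is `c • (p s + p t)` with c slightly above 1/2, just beyond the midpoint of the
-- edge. For each of the finitely many sets `ρ` the face criterion is correct for all c close enough
-- to 1/2 from above, so one c serves them all.
open Filter Topology in
theorem IsRadial.exists_subdivide [Fintype V] [DecidableEq V] [FiniteDimensional ℝ E]
    {K : PreAbstractSimplicialComplex V} {p : V → E} (h : K.IsRadial p) {η : Finset V}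
    (hη : K.IsEdge η) : ∃ q : Option V → E, (K.subdivide η).IsRadial q := by
  obtain ⟨s, t, hst, rfl, he⟩ := isEdge_iff.mp hη
  have hne : ({s, t} : Finset V).Nonempty := by simp
  have : Nonempty V := ⟨s⟩
  let q : ℝ → Option V → E := fun c o => o.elim (c • (p s + p t)) p
  have hlim : ∀ A : ℝ, A < 2 → ∀ᶠ c in 𝓝[>] (1 / 2 : ℝ), c * A < 1 := fun A hA => by
    have h1 : Tendsto (fun c : ℝ => c * A) (𝓝 (1 / 2)) (𝓝 (1 / 2 * A)) :=
      (continuous_id.mul continuous_const).tendsto _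
    exact (h1.mono_left nhdsWithin_le_nhds).eventually_lt_const (by linarith)
  have hpos : ∀ᶠ c in 𝓝[>] (1 / 2 : ℝ), 1 / 2 < c := self_mem_nhdsWithin
  have hfwd : ∀ ρ, (K.subdivide {s, t}).IsSimplex ρ → ∀ᶠ c in 𝓝[>] (1 / 2 : ℝ),
      ∃ l : E →L[ℝ] ℝ, ∀ v, l (q c v) ≤ 1 ∧ (l (q c v) = 1 ↔ v ∈ ρ) := by
    intro ρ hρ
    rw [isSimplex_subdivide hne] at hρ
    obtain ⟨h1, h2, h3⟩ := hρ
    by_cases hn : none ∈ ρ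
    · have h3 := h3 hn
      obtain ⟨l, hl⟩ := (h.isSimplex_iff _).mp h3
      -- The functional `l` supporting `ρ ∪ η` is tilted to `l - δ • m`. Here `m` vanishes on the
      -- old vertices of `ρ`, is positive at the ends of the edge outside `ρ`, and has total 2 on
      -- the edge, so the new vertex gets the value c(2 - 2δ), equal to 1 for δ = 1 - 1/(2c).
      let a : ℝ := if s ∈ ρ.eraseNone then 0 else if t ∈ ρ.eraseNone then 2 else 1
      let b : ℝ := if t ∈ ρ.eraseNone then 0 else if s ∈ ρ.eraseNone then 2 else 1
      have hst' : ¬ (s ∈ ρ.eraseNone ∧ t ∈ ρ.eraseNone) := fun h => h1 (by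
        rw [Finset.insert_subset_iff, Finset.singleton_subset_iff]; exact h)
      have hab : a + b = 2 := by
        by_cases h4 : s ∈ ρ.eraseNone <;> by_cases h5 : t ∈ ρ.eraseNone
        · exact absurd ⟨h4, h5⟩ hst'
        all_goals simp only [a, b, h4, h5, if_true, if_false]; norm_num
      obtain ⟨m, hm⟩ := h.prescribe _ h3 fun v => if v = s then a else if v = t then b else 0
      have hms : m (p s) = a := by rw [hm s (by simp)]; simp
      have hmt : m (p t) = b := by rw [hm t (by simp)]; simp [hst.symm]
      have hls : l (p s) = 1 := (hl s).2.mpr (by simp)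
      have hlt : l (p t) = 1 := (hl t).2.mpr (by simp)
      -- The tilt tends to 0 as c tends to 1/2, so vertices off the face stay strictly below 1.
      have hsmall : ∀ᶠ c in 𝓝[>] (1 / 2 : ℝ), ∀ v, v ∉ ρ.eraseNone ∪ {s, t} →
          l (p v) - (1 - 1 / (2 * c)) * m (p v) < 1 := by
        rw [eventually_all]
        intro v
        by_cases hv : v ∈ ρ.eraseNone ∪ {s, t}
        · exact Eventually.of_forall fun _ h => absurd hv h
        have h4 : ContinuousAt (fun c : ℝ => l (p v) - (1 - 1 / (2 * c)) * m (p v)) (1 / 2) := by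
          refine ContinuousAt.sub continuousAt_const (ContinuousAt.mul ?_ continuousAt_const)
          refine ContinuousAt.sub continuousAt_const (ContinuousAt.div continuousAt_const ?_ ?_)
          · fun_prop
          · norm_num
        have h5 : l (p v) < 1 := lt_of_le_of_ne (hl v).1 fun h => hv ((hl v).2.mp h)
        have h6 := (h4.tendsto.mono_left (nhdsWithin_le_nhds (s := Set.Ioi (1 / 2)))).eventually_lt_const
          (u := 1) (by norm_num; exact h5)
        filter_upwards [h6] with c hc _ using hc
      filter_upwards [hsmall, hpos] with c hc hc0
      set δ : ℝ := 1 - 1 / (2 * c) with hδ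
      have hδ0 : 0 < δ := by
        rw [hδ, sub_pos, div_lt_one (by linarith)]
        linarith
      refine ⟨l - δ • m, ?_⟩
      rintro (_ | v)
      · have : (l - δ • m) (q c none) = 1 := by
          simp only [q, Option.elim_none, map_smul, map_add, sub_apply,
            smul_apply, hms, hmt, hls, hlt, smul_eq_mul]
          rw [show 1 - δ * a + (1 - δ * b) = 2 - δ * 2 by
            linear_combination (-δ) * hab, hδ]
          field_simp
          ring
        simp [this, hn]
      · have hv0 : (l - δ • m) (q c (some v)) = l (p v) - δ * m (p v) := by simp [q]
        rw [hv0, ← Finset.mem_eraseNone]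
        by_cases hv : v ∈ ρ.eraseNone ∪ {s, t}
        · have h4 : (0 ≤ m (p v)) ∧ (m (p v) = 0 ↔ v ∈ ρ.eraseNone) := by
            by_cases hvs : v = s
            · subst hvs
              rw [hms]
              by_cases h4 : v ∈ ρ.eraseNone <;> by_cases h5 : t ∈ ρ.eraseNone <;>
                simp only [a, h4, h5, if_true, if_false] <;> norm_num
            · by_cases hvt : v = t
              · subst hvt
                rw [hmt]
                by_cases h4 : v ∈ ρ.eraseNone <;> by_cases h5 : s ∈ ρ.eraseNone <;>
                  simp only [b, h4, h5, if_true, if_false] <;> norm_num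
              · rw [hm v hv]
                simp only [hvs, hvt, if_false, le_refl, true_and, true_iff]
                simpa [hvs, hvt] using hv
          have h5 : l (p v) = 1 := (hl v).2.mpr hv
          rw [h5, ← h4.2]
          refine ⟨by nlinarith [h4.1], fun h6 => ?_, fun h6 => by rw [h6]; ring⟩
          have : δ * m (p v) = 0 := by linarith
          exact (mul_eq_zero.mp this).resolve_left hδ0.ne'
        · have := hc v hv
          refine ⟨this.le, fun h => absurd h this.ne, fun h => absurd ?_ hv⟩
          exact Finset.mem_union_left _ h
    · obtain ⟨l, hl⟩ := (h.isSimplex_iff _).mp h2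
      have hlt : l (p s) + l (p t) < 2 := by
        by_contra hge
        apply h1
        have hs := (hl s).1
        have ht := (hl t).1
        rw [Finset.insert_subset_iff, Finset.singleton_subset_iff, ← (hl s).2, ← (hl t).2]
        constructor <;> linarith
      filter_upwards [hlim _ hlt] with c hc
      refine ⟨l, ?_⟩
      rintro (_ | v)
      · have : l (q c none) < 1 := by simpa [q, mul_add] using hc
        exact ⟨this.le, fun h => absurd h this.ne, fun h => absurd h hn⟩
      · simpa [q] using hl v
  have hbwd : ∀ ρ, ¬ (K.subdivide {s, t}).IsSimplex ρ → ∀ᶠ c in 𝓝[>] (1 / 2 : ℝ),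
      ¬ ∃ l : E →L[ℝ] ℝ, ∀ v, l (q c v) ≤ 1 ∧ (l (q c v) = 1 ↔ v ∈ ρ) := by
    intro ρ hρ
    rw [isSimplex_subdivide hne] at hρ
    by_cases h1 : {s, t} ⊆ ρ.eraseNone
    · filter_upwards [hpos] with c hc
      rintro ⟨l, hl⟩
      have h2 := (hl none).1
      have h3 := (hl (some s)).2.mpr (by simpa using h1 (by simp : s ∈ _))
      have h4 := (hl (some t)).2.mpr (by simpa using h1 (by simp : t ∈ _))
      simp only [q, Option.elim_none, Option.elim_some, map_smul, map_add, smul_eq_mul] at h2 h3 h4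
      rw [h3, h4] at h2
      linarith
    by_cases h2 : K.IsSimplex ρ.eraseNone
    swap
    · refine Eventually.of_forall fun c => ?_
      rintro ⟨l, hl⟩
      exact h2 ((h.isSimplex_iff _).mpr ⟨l, fun v => by simpa [q] using hl (some v)⟩)
    have h3 : none ∈ ρ ∧ ¬ K.IsSimplex (ρ.eraseNone ∪ {s, t}) := by
      by_contra h3
      exact hρ ⟨h1, h2, fun hn => by_contra fun h4 => h3 ⟨hn, h4⟩⟩
    obtain ⟨hn, h3⟩ := h3
    -- The maximum of `l (p s) + l (p t)` over this compact set is below 2, for otherwise `ρ ∪ η`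
    -- would be a simplex. For c near 1/2 no member of the set can then reach 1 at the new vertex.
    let S := {l : E →L[ℝ] ℝ | (∀ v, l (p v) ≤ 1) ∧ ∀ v ∈ ρ.eraseNone, l (p v) = 1}
    rcases S.eq_empty_or_nonempty with hS | hS
    · refine Eventually.of_forall fun c => ?_
      rintro ⟨l, hl⟩
      have : l ∈ S := ⟨fun v => (hl (some v)).1, fun v hv =>
        (hl (some v)).2.mpr (Finset.mem_eraseNone.mp hv)⟩
      rw [hS] at this
      exact this
    · obtain ⟨l₀, hl₀, hmax⟩ := (h.isCompact_polar ρ.eraseNone).exists_isMaxOn hS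
        (f := fun l => l (p s) + l (p t)) (by fun_prop)
      have hlt : l₀ (p s) + l₀ (p t) < 2 := by
        by_contra hge
        have hs := hl₀.1 s
        have ht := hl₀.1 t
        apply h3
        have := (h.isSimplex_iff (Finset.univ.filter fun v => l₀ (p v) = 1)).mpr
          ⟨l₀, fun v => ⟨hl₀.1 v, by simp⟩⟩
        refine this.mono fun v hv => ?_
        simp only [Finset.mem_union, Finset.mem_insert, Finset.mem_singleton] at hv
        simp only [Finset.mem_filter, Finset.mem_univ, true_and]
        rcases hv with hv | rfl | rfl
        · exact hl₀.2 v hv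
        · linarith
        · linarith
      filter_upwards [hlim _ hlt, hpos] with c hc hc0
      rintro ⟨l, hl⟩
      have h4 : l ∈ S := ⟨fun v => (hl (some v)).1, fun v hv =>
        (hl (some v)).2.mpr (Finset.mem_eraseNone.mp hv)⟩
      have h5 : l (p s) + l (p t) ≤ l₀ (p s) + l₀ (p t) := hmax h4
      have h6 := (hl none).2.mpr hn
      simp only [q, Option.elim_none, map_smul, map_add, smul_eq_mul] at h6
      nlinarith
  have hall : ∀ᶠ c in 𝓝[>] (1 / 2 : ℝ), ∀ ρ, (K.subdivide {s, t}).IsSimplex ρ ↔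
      ∃ l : E →L[ℝ] ℝ, ∀ v, l (q c v) ≤ 1 ∧ (l (q c v) = 1 ↔ v ∈ ρ) := by
    rw [eventually_all]
    intro ρ
    by_cases hρ : (K.subdivide {s, t}).IsSimplex ρ
    · filter_upwards [hfwd ρ hρ] with c hc using iff_of_true hρ hc
    · filter_upwards [hbwd ρ hρ] with c hc using iff_of_false hρ hc
  obtain ⟨c, hc, hc0⟩ := (hall.and hpos).exists
  refine ⟨q c, fun l hl => h.eq_zero l fun v => hl (some v), ?_, hc, ?_⟩
  · rintro (_ | v)
    · rw [isSimplex_subdivide hne]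
      simpa [isSimplex_empty] using he
    · rw [isSimplex_subdivide hne]
      have : ({some v} : Finset (Option V)).eraseNone = {v} := by ext; simp
      rw [this]
      refine ⟨fun h1 => hst ?_, h.vertex v, by simp⟩
      have h2 := h1 (by simp : s ∈ _)
      have h3 := h1 (by simp : t ∈ _)
      rw [Finset.mem_singleton] at h2 h3
      rw [h2, h3]
  · intro ρ hρ g
    rw [isSimplex_subdivide hne] at hρ
    obtain ⟨h1, h2, h3⟩ := hρ
    by_cases hn : none ∈ ρ
    · have h3 := h3 hn
      -- The end `y` of the edge lies outside `ρ`, so its value is free and is adjusted to give the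
      -- new vertex the prescribed value.
      have key : ∀ x y, x ≠ y → ({s, t} : Finset V) = {x, y} → y ∉ ρ.eraseNone →
          c • (p x + p y) = q c none → ∃ l : E →L[ℝ] ℝ, ∀ v ∈ ρ, l (q c v) = g v := by
        intro x y hxy hη hy hq
        rw [hη] at h3
        obtain ⟨l, hl⟩ := h.prescribe _ h3 fun v =>
          if v = y then g none / c - g (some x) else g (some v)
        refine ⟨l, ?_⟩
        rintro (_ | v) hv
        · rw [← hq, map_smul, map_add, hl x (by simp), hl y (by simp)]
          simp only [hxy, if_false, if_true, smul_eq_mul]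
          field_simp
          ring
        · have hv' := Finset.mem_eraseNone.mpr hv
          have : v ≠ y := fun h => hy (h ▸ hv')
          simp only [q, Option.elim_some]
          rw [hl v (Finset.mem_union_left _ hv'), if_neg this]
      by_cases ht : t ∈ ρ.eraseNone
      · refine key t s hst.symm (Finset.pair_comm _ _) (fun hs => h1 ?_) ?_
        · rw [Finset.insert_subset_iff, Finset.singleton_subset_iff]
          exact ⟨hs, ht⟩
        · simp [q, add_comm]
      · exact key s t hst rfl ht rfl
    · obtain ⟨l, hl⟩ := h.prescribe _ h2 fun v => g (some v)
      refine ⟨l, ?_⟩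
      rintro (_ | v) hv
      · exact absurd hv hn
      · exact hl v (Finset.mem_eraseNone.mpr hv)

end Radial

/-! ### Radial realizations versus convex triangulations -/

section Convex

variable {V W E F : Type*} [NormedAddCommGroup E] [NormedSpace ℝ E] [NormedAddCommGroup F]
  [NormedSpace ℝ F]

theorem exists_weights_of_mem_convexHull [Fintype V] {p : V → E} {x : E}
    (hx : x ∈ convexHull ℝ (Set.range p)) : ∃ w ∈ stdSimplex ℝ V, ∑ v, w v • p v = x := by
  classical
  have h : convexHull ℝ (Set.range p) = Fintype.linearCombination ℝ p '' stdSimplex ℝ V := by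
    rw [← convexHull_rangle_single_eq_stdSimplex, LinearMap.image_convexHull, ← Set.range_comp]
    congr 2
    ext v
    simp
  rw [h] at hx
  obtain ⟨w, hw, rfl⟩ := hx
  exact ⟨w, hw, by rw [Fintype.linearCombination_apply]⟩

theorem le_of_mem_convexHull {s : Set E} (l : E →L[ℝ] ℝ) {c : ℝ} (h : ∀ x ∈ s, l x ≤ c) {x : E}
    (hx : x ∈ convexHull ℝ s) : l x ≤ c :=
  convexHull_min (t := {x | l x ≤ c}) h
    (convex_halfSpace_le (l : E →ₗ[ℝ] ℝ).isLinear c) hx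

theorem eq_zero_of_le_of_mem_interior {s : Set E} {x : E} (hx : x ∈ interior s) (l : E →L[ℝ] ℝ)
    (h : ∀ y ∈ s, l y ≤ l x) : l = 0 := by
  obtain ⟨r, hr, hball⟩ := Metric.mem_nhds_iff.mp (mem_interior_iff_mem_nhds.mp hx)
  by_contra hl
  obtain ⟨y, hy⟩ : ∃ y, l y ≠ 0 := by
    by_contra! h
    exact hl (ContinuousLinearMap.ext h)
  wlog hpos : 0 < l y generalizing y
  · exact this (-y) (by simpa using hy) (by
      rw [map_neg]; have := lt_of_le_of_ne (not_lt.mp hpos) hy; linarith)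
  have hy0 : 0 < ‖y‖ := norm_pos_iff.mpr fun h => hy (by simp [h])
  have hmem : x + (r / (2 * ‖y‖)) • y ∈ Metric.ball x r := by
    rw [mem_ball_iff_norm, add_sub_cancel_left, norm_smul, Real.norm_of_nonneg (by positivity)]
    rw [div_mul_eq_mul_div, div_lt_iff₀ (by positivity)]
    nlinarith
  have := h _ (hball hmem)
  rw [map_add, map_smul, smul_eq_mul] at this
  have h2 : 0 < r / (2 * ‖y‖) * l y := by positivity
  linarith

namespace IsRadial

variable {K : PreAbstractSimplicialComplex V} {p : V → E}

theorem nonempty [Nontrivial E] (h : K.IsRadial p) : Nonempty V := by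
  by_contra hV
  rw [not_nonempty_iff] at hV
  obtain ⟨x, hx⟩ := exists_ne (0 : E)
  obtain ⟨l, hl⟩ := SeparatingDual.exists_ne_zero (R := ℝ) hx
  exact hl (by rw [h.eq_zero l fun v => hV.elim v]; rfl)

theorem injective (h : K.IsRadial p) : Function.Injective p := by
  intro v w hvw
  obtain ⟨l, hl⟩ := (h.isSimplex_iff {v}).mp (h.vertex v)
  have h1 := (hl v).2.mpr (by simp)
  rw [hvw] at h1
  exact (Finset.mem_singleton.mp ((hl w).2.mp h1)).symm

/-- A point outside the hull is separated from it by some `f`; as `f` reaches `r * ‖f‖` at a vertex,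
the point has norm at least `r`. -/
theorem exists_ball_subset [Fintype V] [Nonempty V] [FiniteDimensional ℝ E] (h : K.IsRadial p) :
    ∃ r > 0, Metric.ball 0 r ⊆ convexHull ℝ (Set.range p) := by
  obtain ⟨r, hr, hl⟩ := h.exists_lower_bound
  refine ⟨r, hr, fun x hx => ?_⟩
  by_contra hxs
  obtain ⟨f, u, hf, hu⟩ := geometric_hahn_banach_closed_point (convex_convexHull ℝ (Set.range p))
    ((Set.finite_range p).isClosed_convexHull ℝ) hxs
  obtain ⟨v, hv⟩ := hl f
  have h1 := hf _ (subset_convexHull ℝ _ ⟨v, rfl⟩)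
  have h2 : f x ≤ ‖f‖ * ‖x‖ := (le_abs_self _).trans (f.le_opNorm x)
  have h3 : ‖x‖ < r := by simpa using hx
  nlinarith [norm_nonneg f]

theorem zero_mem_interior [Fintype V] [Nonempty V] [FiniteDimensional ℝ E] (h : K.IsRadial p) :
    (0 : E) ∈ interior (convexHull ℝ (Set.range p)) := by
  obtain ⟨r, hr, hb⟩ := h.exists_ball_subset
  exact mem_interior_iff_mem_nhds.mpr (Filter.mem_of_superset (Metric.ball_mem_nhds _ hr) hb)

/-- Each vertex is exposed by the functional belonging to its singleton simplex. -/
theorem extremePoints_eq [Fintype V] (h : K.IsRadial p) :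
    (convexHull ℝ (Set.range p)).extremePoints ℝ = Set.range p := by
  refine Set.Subset.antisymm extremePoints_convexHull_subset ?_
  rintro _ ⟨v, rfl⟩
  apply exposedPoints_subset_extremePoints
  obtain ⟨l, hl⟩ := (h.isSimplex_iff {v}).mp (h.vertex v)
  have hv : l (p v) = 1 := (hl v).2.mpr (by simp)
  refine ⟨subset_convexHull ℝ _ ⟨v, rfl⟩, l, fun y hy => ⟨?_, fun hy1 => ?_⟩⟩
  · rw [hv]
    exact le_of_mem_convexHull l (by rintro _ ⟨w, rfl⟩; exact (hl w).1) hy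
  · obtain ⟨w, hw, rfl⟩ := exists_weights_of_mem_convexHull hy
    rw [hv, map_sum] at hy1
    simp only [map_smul, smul_eq_mul] at hy1
    have h0 : ∑ u, w u * (1 - l (p u)) ≤ 0 := by
      simp only [mul_sub, mul_one, Finset.sum_sub_distrib, hw.2]
      linarith
    have h1 : ∀ u, u ≠ v → w u = 0 := by
      intro u hu
      have h2 := (Finset.single_le_sum (f := fun u => w u * (1 - l (p u))) (fun u _ =>
        mul_nonneg (hw.1 u) (by linarith [(hl u).1])) (Finset.mem_univ u)).trans h0
      have h3 : l (p u) < 1 := lt_of_le_of_ne (hl u).1 fun h => hu (by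
        simpa using (hl u).2.mp h)
      have h4 := hw.1 u
      by_contra h5
      have : 0 < w u := lt_of_le_of_ne h4 (Ne.symm h5)
      have := mul_pos this (sub_pos.mpr h3)
      linarith
    have h2 : w v = 1 := by
      rw [← hw.2, Finset.sum_eq_single v (fun u _ hu => h1 u hu) (by simp)]
    rw [Finset.sum_eq_single v (fun u _ hu => by rw [h1 u hu, zero_smul]) (by simp), h2, one_smul]

theorem isConvexSphereTriangulation [Fintype V] [FiniteDimensional ℝ E] (h : K.IsRadial p)
    {n : ℕ} (hn : Module.finrank ℝ E = n + 1) : K.IsConvexSphereTriangulation n := by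
  let e : E ≃L[ℝ] EuclideanSpace ℝ (Fin (n + 1)) :=
    ContinuousLinearEquiv.ofFinrankEq (by simpa using hn)
  replace h := h.map e
  have : Nonempty V := h.nonempty
  refine ⟨_, h.injective, ⟨0, h.zero_mem_interior⟩, h.extremePoints_eq, fun σ => ?_, fun σ hσ => ?_⟩
  · rw [mem_faces_iff, h.isSimplex_iff]
    constructor
    · rintro ⟨hne, l, hl⟩
      refine ⟨hne, ?_, l, 1, hl⟩
      rintro rfl
      have h1 : -l = 0 := h.eq_zero (-l) fun v => by
        rw [neg_apply, (hl v).2.mpr (by simp)]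
        norm_num
      have h2 := (hl (Classical.arbitrary V)).2.mpr (by simp)
      rw [neg_eq_zero.mp h1] at h2
      simp at h2
    · rintro ⟨hne, huniv, l, c, hl⟩
      refine ⟨hne, ?_⟩
      -- A nonpositive level would force `l = 0` and `c = 0`, and the face would be everything.
      -- Positive levels are rescaled to 1.
      have hc : 0 < c := by
        by_contra hc
        have h1 := h.eq_zero l fun v => (hl v).1.trans (not_lt.mp hc)
        subst h1
        apply huniv
        have h2 := (hl (Classical.arbitrary V)).1
        have h3 : c = 0 := le_antisymm (not_lt.mp hc) (by simpa using h2)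
        ext v
        simpa [h3] using (hl v).2
      refine ⟨c⁻¹ • l, fun v => ?_⟩
      rw [smul_apply, smul_eq_mul, inv_mul_le_one₀ hc, inv_mul_eq_one₀ hc.ne', ← (hl v).2,
        eq_comm (a := c)]
      exact ⟨(hl v).1, Iff.rfl⟩
  · classical
    rw [affineIndependent_iff]
    intro s w _ hw v hv
    -- A functional whose values are the coefficients themselves turns the relation into a vanishing
    -- sum of squares.
    obtain ⟨l, hl⟩ := h.prescribe σ (mem_faces_iff.mp hσ).2
      fun v => if hv : v ∈ σ then w ⟨v, hv⟩ else 0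
    have h1 := congrArg l hw
    rw [map_sum, map_zero] at h1
    have h2 : ∑ v ∈ s, w v * w v = 0 := by
      rw [← h1]
      refine Finset.sum_congr rfl fun v _ => ?_
      rw [map_smul, smul_eq_mul, hl v v.2, dif_pos v.2]
    exact mul_self_eq_zero.mp
      ((Finset.sum_eq_zero_iff_of_nonneg fun v _ => mul_self_nonneg (w v)).mp h2 v hv)

end IsRadial

/-- An interior point `x₀` of the polytope is moved to the origin. This makes an arbitrary convex
factor of a join accessible to `IsRadial.join`. -/
theorem exists_isRadial_of_isConvexSphereTriangulation [Fintype V]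
    {K : PreAbstractSimplicialComplex V} {n : ℕ} (hK : K.IsConvexSphereTriangulation n) :
    ∃ q : V → EuclideanSpace ℝ (Fin (n + 1)), K.IsRadial q := by
  classical
  obtain ⟨p, hinj, ⟨x₀, hx₀⟩, hext, hfaces, hind⟩ := hK
  have hzero : ∀ l : EuclideanSpace ℝ (Fin (n + 1)) →L[ℝ] ℝ, (∀ v, l (p v) ≤ l x₀) → l = 0 :=
    fun l hl => eq_zero_of_le_of_mem_interior hx₀ l fun y hy =>
      le_of_mem_convexHull l (by rintro _ ⟨v, rfl⟩; exact hl v) hy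
  have hV : Nonempty V := by
    by_contra hV
    rw [not_nonempty_iff] at hV
    rw [Set.range_eq_empty, convexHull_empty, interior_empty] at hx₀
    exact hx₀
  have hsimplex : ∀ σ : Finset V, K.IsSimplex σ ↔
      ∃ l : EuclideanSpace ℝ (Fin (n + 1)) →L[ℝ] ℝ,
        ∀ v, l (p v - x₀) ≤ 1 ∧ (l (p v - x₀) = 1 ↔ v ∈ σ) := by
    intro σ
    rcases σ.eq_empty_or_nonempty with rfl | hne
    · exact iff_of_true (isSimplex_empty K) ⟨0, by simp⟩
    rw [← and_iff_right (a := σ.Nonempty) (b := K.IsSimplex σ) hne, ← mem_faces_iff, hfaces]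
    constructor
    · rintro ⟨-, huniv, l, c, hl⟩
      have hc : l x₀ < c := by
        have h1 : l x₀ ≤ c := le_of_mem_convexHull l (by rintro _ ⟨v, rfl⟩; exact (hl v).1)
          (interior_subset hx₀)
        refine lt_of_le_of_ne h1 fun h2 => huniv ?_
        have h3 := hzero l fun v => h2 ▸ (hl v).1
        subst h3
        ext v
        rw [← (hl v).2, ← h2]
        simp
      refine ⟨(c - l x₀)⁻¹ • l, fun v => ?_⟩
      have hc' := sub_pos.mpr hc
      rw [smul_apply, smul_eq_mul, inv_mul_le_one₀ hc', inv_mul_eq_one₀ hc'.ne', ← (hl v).2,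
        map_sub]
      exact ⟨by linarith [(hl v).1], fun h => by linarith, fun h => by linarith⟩
    · rintro ⟨l, hl⟩
      refine ⟨hne, ?_, l, 1 + l x₀, fun v => ?_⟩
      · rintro rfl
        have h1 : -l = 0 := hzero (-l) fun v => by
          have := (hl v).2.mpr (by simp)
          rw [map_sub] at this
          rw [neg_apply, neg_apply]
          linarith
        have h2 := (hl (Classical.arbitrary V)).2.mpr (by simp)
        rw [neg_eq_zero.mp h1] at h2
        simp at h2
      · have := hl v
        rw [map_sub] at this
        rw [← this.2]
        exact ⟨by linarith, fun h => by linarith, fun h => by linarith⟩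
  refine ⟨fun v => p v - x₀, fun l hl => hzero l fun v => ?_, fun v => ?_, hsimplex, ?_⟩
  · have := hl v
    rw [map_sub] at this
    linarith
  · have hv : p v ∈ (convexHull ℝ (Set.range p)).extremePoints ℝ := by
      rw [hext]; exact ⟨v, rfl⟩
    -- An extreme point is not in the closed hull of the other vertices, and a functional separating
    -- it from them exposes it.
    rw [(convex_convexHull ℝ _).mem_extremePoints_iff_mem_sdiff_convexHull_sdiff] at hv
    have hnot : p v ∉ convexHull ℝ (Set.range p \ {p v}) := fun h =>
      hv.2 (convexHull_mono (Set.sdiff_subset_sdiff_left (subset_convexHull ℝ _)) h)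
    obtain ⟨l, u, hl, hu⟩ := geometric_hahn_banach_closed_point
      (convex_convexHull ℝ (Set.range p \ {p v}))
      (((Set.finite_range p).subset Set.sdiff_subset).isClosed_convexHull ℝ) hnot
    have hlt : ∀ w, w ≠ v → l (p w) < l (p v) := fun w hw =>
      (hl _ (subset_convexHull ℝ _ ⟨⟨w, rfl⟩, fun h => hw (hinj h)⟩)).trans hu
    refine (mem_faces_iff.mp ((hfaces {v}).mpr ⟨by simp, fun huniv => ?_, l, l (p v), fun w => ?_⟩)).2
    · have hs : ∀ w, w = v := fun w => by
        have := Finset.mem_univ w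
        rwa [← huniv, Finset.mem_singleton] at this
      have hr : Set.range p = {p v} := by
        ext y
        constructor
        · rintro ⟨w, rfl⟩; rw [hs w]; rfl
        · rintro rfl; exact ⟨v, rfl⟩
      rw [hr, convexHull_singleton, interior_singleton] at hx₀
      exact hx₀
    · by_cases hw : w = v
      · simp [hw]
      · exact ⟨(hlt w hw).le, fun h => absurd h (hlt w hw).ne, fun h => absurd (by simpa using h) hw⟩
  · intro σ hσ g
    rcases σ.eq_empty_or_nonempty with rfl | hne
    · exact ⟨0, by simp⟩
    obtain ⟨l, hl⟩ := (hsimplex σ).mp hσ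
    -- Since `l` equals 1 at all translated vertices of `σ`, coefficients of a linear relation sum
    -- to 0, so the relation is affine and hence trivial.
    have hker : LinearMap.ker (Fintype.linearCombination ℝ fun v : σ => p v - x₀) = ⊥ := by
      rw [LinearMap.ker_eq_bot']
      intro w hw
      rw [Fintype.linearCombination_apply] at hw
      have h1 : ∑ v, w v = 0 := by
        have := congrArg l hw
        rw [map_sum, map_zero] at this
        rw [← this]
        refine Finset.sum_congr rfl fun v _ => ?_
        rw [map_smul, (hl v).2.mpr v.2, smul_eq_mul, mul_one]
      have h2 : ∑ v, w v • p v = 0 := by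
        simp only [smul_sub, Finset.sum_sub_distrib, ← Finset.sum_smul, h1, zero_smul,
          sub_zero] at hw
        exact hw
      ext v
      exact affineIndependent_iff.mp (hind σ (mem_faces_iff.mpr ⟨hne, hσ⟩)) Finset.univ w h1 h2 v
        (Finset.mem_univ v)
    obtain ⟨f, hf⟩ := LinearMap.exists_leftInverse_of_injective _ hker
    refine ⟨LinearMap.toContinuousLinearMap
      ((Fintype.linearCombination ℝ fun v : σ => g v) ∘ₗ f), fun v hv => ?_⟩
    have h1 : f (p v - x₀) = Pi.single (⟨v, hv⟩ : σ) 1 := by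
      have := LinearMap.congr_fun hf (Pi.single (⟨v, hv⟩ : σ) 1)
      simpa using this
    simp [h1]

end Convex

/-! ### Topological spheres: joins and radial projection -/

section Topology

variable {V W E F : Type*} [NormedAddCommGroup E] [NormedSpace ℝ E] [NormedAddCommGroup F]
  [NormedSpace ℝ F]

theorem inv_norm_smul_mem_sphere {x : E} (hx : x ≠ 0) :
    ‖x‖⁻¹ • x ∈ Metric.sphere (0 : E) 1 := by
  simp [norm_smul, hx]

theorem ne_zero_of_mem_sphere_one {E : Type*} [NormedAddCommGroup E] {x : E} (hx : x ∈ Metric.sphere (0 : E) 1) : x ≠ 0 := by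
  rintro rfl
  simp at hx

/-- A linear equivalence induces a homeomorphism of unit spheres. -/
noncomputable def sphereHomeomorph (e : E ≃L[ℝ] F) :
    Metric.sphere (0 : E) 1 ≃ₜ Metric.sphere (0 : F) 1 where
  toFun x := ⟨‖e x‖⁻¹ • e x, inv_norm_smul_mem_sphere
    (e.map_eq_zero_iff.not.mpr (ne_zero_of_mem_sphere_one x.2))⟩
  invFun y := ⟨‖e.symm y‖⁻¹ • e.symm y, inv_norm_smul_mem_sphere
    (e.symm.map_eq_zero_iff.not.mpr (ne_zero_of_mem_sphere_one y.2))⟩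
  left_inv x := by
    have h := norm_ne_zero_iff.mpr (e.map_eq_zero_iff.not.mpr (ne_zero_of_mem_sphere_one x.2))
    have h1 : ‖(x : E)‖ = 1 := mem_sphere_zero_iff_norm.mp x.2
    ext
    simp [norm_smul, h1, smul_smul, h]
  right_inv y := by
    have h := norm_ne_zero_iff.mpr
      (e.symm.map_eq_zero_iff.not.mpr (ne_zero_of_mem_sphere_one y.2))
    have h1 : ‖(y : F)‖ = 1 := mem_sphere_zero_iff_norm.mp y.2
    ext
    simp [norm_smul, h1, smul_smul, h]
  continuous_toFun := by
    refine Continuous.subtype_mk (Continuous.smul (Continuous.inv₀ (by fun_prop) fun x => ?_)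
      (by fun_prop)) _
    exact norm_ne_zero_iff.mpr (e.map_eq_zero_iff.not.mpr (ne_zero_of_mem_sphere_one x.2))
  continuous_invFun := by
    refine Continuous.subtype_mk (Continuous.smul (Continuous.inv₀ (by fun_prop) fun x => ?_)
      (by fun_prop)) _
    exact norm_ne_zero_iff.mpr (e.symm.map_eq_zero_iff.not.mpr (ne_zero_of_mem_sphere_one x.2))

/-- Any normed space of the right dimension may replace Euclidean space; the join uses an ℓ¹
product. -/
theorem isSphereTriangulation_iff [Fintype V] [FiniteDimensional ℝ E]
    {K : PreAbstractSimplicialComplex V} {n : ℕ} (hn : Module.finrank ℝ E = n + 1) :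
    K.IsSphereTriangulation n ↔ Nonempty (K.realization ≃ₜ Metric.sphere (0 : E) 1) := by
  let e : E ≃L[ℝ] EuclideanSpace ℝ (Fin (n + 1)) :=
    ContinuousLinearEquiv.ofFinrankEq (by simpa using hn)
  exact ⟨fun ⟨f⟩ => ⟨f.trans (sphereHomeomorph e).symm⟩, fun ⟨f⟩ => ⟨f.trans (sphereHomeomorph e)⟩⟩

/-- The cone over the geometric realization: nonnegative weights supported on a simplex. -/
def cone (K : PreAbstractSimplicialComplex V) : Set (V → ℝ) :=
  {x | (∀ v, 0 ≤ x v) ∧ ∃ σ, K.IsSimplex σ ∧ ∀ v, v ∉ σ → x v = 0}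

theorem mem_realization_iff [Fintype V] {K : PreAbstractSimplicialComplex V} {x : V → ℝ} :
    x ∈ K.realization ↔ x ∈ K.cone ∧ ∑ v, x v = 1 := by
  constructor
  · rintro ⟨⟨h0, h1⟩, σ, hσ, h⟩
    exact ⟨⟨h0, σ, Or.inr hσ, h⟩, h1⟩
  · rintro ⟨⟨h0, σ, hσ, h⟩, h1⟩
    refine ⟨⟨h0, h1⟩, σ, ?_, h⟩
    rcases hσ with rfl | hσ
    · simp [h] at h1
    · exact hσ

theorem smul_mem_cone {K : PreAbstractSimplicialComplex V} {x : V → ℝ} (hx : x ∈ K.cone) {c : ℝ}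
    (hc : 0 ≤ c) : c • x ∈ K.cone := by
  obtain ⟨h0, σ, hσ, h⟩ := hx
  exact ⟨fun v => mul_nonneg hc (h0 v), σ, hσ, fun v hv => by simp [h v hv]⟩

theorem eq_zero_of_mem_cone [Fintype V] {K : PreAbstractSimplicialComplex V} {x : V → ℝ}
    (hx : x ∈ K.cone) (h : ∑ v, x v = 0) : x = 0 := by
  ext v
  exact (Finset.sum_eq_zero_iff_of_nonneg fun v _ => hx.1 v).mp h v (Finset.mem_univ v)

theorem mem_cone_join {K : PreAbstractSimplicialComplex V} {L : PreAbstractSimplicialComplex W}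
    {z : V ⊕ W → ℝ} :
    z ∈ (K.join L).cone ↔ (z ∘ Sum.inl) ∈ K.cone ∧ (z ∘ Sum.inr) ∈ L.cone := by
  constructor
  · rintro ⟨h0, σ, hσ, h⟩
    rw [isSimplex_join] at hσ
    exact ⟨⟨fun v => h0 _, _, hσ.1, fun v hv => h _ (by simpa using hv)⟩,
      ⟨fun v => h0 _, _, hσ.2, fun v hv => h _ (by simpa using hv)⟩⟩
  · rintro ⟨⟨h0, σ, hσ, h⟩, h0', τ, hτ, h'⟩
    refine ⟨?_, σ.disjSum τ, ?_, ?_⟩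
    · rintro (v | w)
      exacts [h0 v, h0' w]
    · rw [isSimplex_join]
      simpa using ⟨hσ, hτ⟩
    · rintro (v | w) hv
      exacts [h v (by simpa using hv), h' w (by simpa using hv)]

theorem isCompact_realization [Fintype V] (K : PreAbstractSimplicialComplex V) :
    IsCompact K.realization := by
  have : K.realization = stdSimplex ℝ V ∩ ⋃ σ ∈ K.faces, {x | ∀ v, v ∉ σ → x v = 0} := by
    ext x
    simp [realization]
  rw [this]
  refine (isCompact_stdSimplex ℝ V).inter_right ((Set.toFinite _).isClosed_biUnion fun σ _ => ?_)
  simp only [Set.ofPred_forall]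
  exact isClosed_iInter fun v => isClosed_iInter fun _ => isClosed_eq (by fun_prop) (by fun_prop)

theorem nonempty_homeomorph_of_bijective {E : Type*} [NormedAddCommGroup E] [Fintype V] {K : PreAbstractSimplicialComplex V}
    {f : K.realization → Metric.sphere (0 : E) 1} (hf : Continuous f)
    (hb : Function.Bijective f) : Nonempty (K.realization ≃ₜ Metric.sphere (0 : E) 1) := by
  have : CompactSpace K.realization := isCompact_iff_compactSpace.mp K.isCompact_realization
  exact ⟨Continuous.homeoOfEquivCompactToT2 (f := Equiv.ofBijective f hb) hf⟩

/-- The homeomorphism of a realization with a unit sphere extends radially to the cones. -/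
theorem exists_coneMap [Fintype V] {K : PreAbstractSimplicialComplex V}
    (f : K.realization ≃ₜ Metric.sphere (0 : E) 1) :
    ∃ G : (V → ℝ) → E, ContinuousOn G K.cone ∧ (∀ x ∈ K.cone, ‖G x‖ = ∑ v, x v) ∧
      Set.InjOn G K.cone ∧ ∀ y, ∃ x ∈ K.cone, G x = y := by
  classical
  -- Weights are normalized to total 1. On the cone this fails only at the apex, where the value of
  -- `G` is 0 in either branch.
  let N : (V → ℝ) → (V → ℝ) := fun x => (∑ v, x v)⁻¹ • x
  let G : (V → ℝ) → E := fun x =>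
    if h : N x ∈ K.realization then (∑ v, x v) • (f ⟨N x, h⟩ : E) else 0
  have hN : ∀ x ∈ K.cone, x ≠ 0 → N x ∈ K.realization := by
    intro x hx h0
    have hs : ∑ v, x v ≠ 0 := fun h => h0 (eq_zero_of_mem_cone hx h)
    rw [mem_realization_iff]
    refine ⟨smul_mem_cone hx (inv_nonneg.mpr (Finset.sum_nonneg fun v _ => hx.1 v)), ?_⟩
    simp only [N, Pi.smul_apply, smul_eq_mul, ← Finset.mul_sum]
    exact inv_mul_cancel₀ hs
  have hG0 : G 0 = 0 := by
    simp only [G]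
    split_ifs <;> simp
  have hG : ∀ x (hx : x ∈ K.cone) (h0 : x ≠ 0), G x = (∑ v, x v) • (f ⟨N x, hN x hx h0⟩ : E) :=
    fun x hx h0 => dif_pos (hN x hx h0)
  have hf : ∀ x, ‖(f x : E)‖ = 1 := fun x => mem_sphere_zero_iff_norm.mp (f x).2
  have hnorm : ∀ x ∈ K.cone, ‖G x‖ = ∑ v, x v := by
    intro x hx
    by_cases h0 : x = 0
    · simp [h0, hG0]
    · rw [hG x hx h0, norm_smul, hf, mul_one, Real.norm_of_nonneg]
      exact Finset.sum_nonneg fun v _ => hx.1 v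
  refine ⟨G, fun x hx => ?_, hnorm, fun x hx y hy hxy => ?_, fun y => ?_⟩
  · by_cases h0 : x = 0
    · subst h0
      -- At the apex continuity follows from the norm formula, since the total weight tends to 0.
      rw [ContinuousWithinAt, hG0, tendsto_zero_iff_norm_tendsto_zero]
      have h1 : Filter.Tendsto (fun x : V → ℝ => ∑ v, x v) (nhdsWithin 0 K.cone) (nhds 0) := by
        have : Continuous fun x : V → ℝ => ∑ v, x v := by fun_prop
        simpa using (this.tendsto 0).mono_left nhdsWithin_le_nhds
      refine h1.congr' ?_
      filter_upwards [self_mem_nhdsWithin] with x hx using (hnorm x hx).symm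
    · let S : Set (V → ℝ) := K.cone ∩ {x | x ≠ 0}
      have hS : S ∈ nhdsWithin x K.cone :=
        Filter.inter_mem self_mem_nhdsWithin (nhdsWithin_le_nhds (isOpen_ne.mem_nhds h0))
      have hxS : x ∈ S := ⟨hx, h0⟩
      refine ContinuousWithinAt.mono_of_mem_nhdsWithin ?_ hS
      refine ContinuousOn.continuousWithinAt ?_ hxS
      rw [continuousOn_iff_continuous_domRestrict]
      have h1 : S.domRestrict G = fun x => (∑ v, x.1 v) • (f ⟨N x.1, hN x.1 x.2.1 x.2.2⟩ : E) := by
        ext1 x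
        exact hG x.1 x.2.1 x.2.2
      rw [h1]
      have hsum : Continuous fun x : S => ∑ v, x.1 v :=
        continuous_finsetSum _ fun v _ => (continuous_apply v).comp continuous_subtype_val
      refine Continuous.smul hsum (continuous_subtype_val.comp (f.continuous.comp
        (Continuous.subtype_mk (Continuous.smul (Continuous.inv₀ hsum ?_)
          continuous_subtype_val) _)))
      intro x h
      exact x.2.2 (eq_zero_of_mem_cone x.2.1 h)
  · have hs : ∑ v, x v = ∑ v, y v := by rw [← hnorm x hx, ← hnorm y hy, hxy]
    by_cases hx0 : x = 0
    · subst hx0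
      exact (eq_zero_of_mem_cone hy (by rw [← hs]; simp)).symm
    · have hsx : ∑ v, x v ≠ 0 := fun h => hx0 (eq_zero_of_mem_cone hx h)
      have hy0 : y ≠ 0 := by
        rintro rfl
        exact hsx (by rw [hs]; simp)
      rw [hG x hx hx0, hG y hy hy0, ← hs] at hxy
      have h1 := f.injective (Subtype.ext (smul_right_injective E hsx hxy))
      have h2 : N x = N y := congrArg Subtype.val h1
      simp only [N, ← hs] at h2
      exact smul_right_injective _ (inv_ne_zero hsx) h2
  · by_cases hy : y = 0
    · exact ⟨0, ⟨fun v => le_rfl, ∅, isSimplex_empty K, fun v _ => rfl⟩, by rw [hG0, hy]⟩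
    · let z := f.symm ⟨‖y‖⁻¹ • y, inv_norm_smul_mem_sphere hy⟩
      have hz := mem_realization_iff.mp z.2
      have hy' : ‖y‖ ≠ 0 := norm_ne_zero_iff.mpr hy
      have hsum : ∑ v, (‖y‖ • z.1) v = ‖y‖ := by
        simp only [Pi.smul_apply, smul_eq_mul, ← Finset.mul_sum, hz.2, mul_one]
      have hc := smul_mem_cone hz.1 (norm_nonneg y)
      refine ⟨‖y‖ • z.1, hc, ?_⟩
      have h0 : ‖y‖ • z.1 ≠ 0 := fun h => hy' (by rw [← hsum, h]; simp)
      have h1 : (⟨N (‖y‖ • z.1), hN _ hc h0⟩ : K.realization) = z := by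
        ext1
        simp only [N, hsum, smul_smul, inv_mul_cancel₀ hy', one_smul]
      rw [hG _ hc h0, h1, hsum]
      simp only [z, f.apply_symm_apply, smul_smul, mul_inv_cancel₀ hy', one_smul]

/-- The cone over a join is the product of the cones. In the ℓ¹ norm the image of a pair has norm
equal to its total weight, so total weight 1 corresponds exactly to the unit sphere. -/
theorem IsSphereTriangulation.join [Fintype V] [Fintype W] {K : PreAbstractSimplicialComplex V}
    {L : PreAbstractSimplicialComplex W} {m n : ℕ} (hK : K.IsSphereTriangulation m)
    (hL : L.IsSphereTriangulation n) : (K.join L).IsSphereTriangulation (m + n + 1) := by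
  obtain ⟨f⟩ := hK
  obtain ⟨g⟩ := hL
  obtain ⟨G, hG, hGn, hGi, hGs⟩ := exists_coneMap f
  obtain ⟨H, hH, hHn, hHi, hHs⟩ := exists_coneMap g
  let E := WithLp 1 (EuclideanSpace ℝ (Fin (m + 1)) × EuclideanSpace ℝ (Fin (n + 1)))
  have hfin : Module.finrank ℝ E = m + n + 1 + 1 := by
    rw [LinearEquiv.finrank_eq (WithLp.linearEquiv 1 ℝ _), Module.finrank_prod,
      finrank_euclideanSpace_fin, finrank_euclideanSpace_fin]
    ring
  have : FiniteDimensional ℝ E := Module.finite_of_finrank_pos (by rw [hfin]; omega)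
  rw [isSphereTriangulation_iff (E := E) hfin]
  have hz : ∀ z ∈ (K.join L).realization, z ∘ Sum.inl ∈ K.cone ∧ z ∘ Sum.inr ∈ L.cone ∧
      ∑ v, (z ∘ Sum.inl) v + ∑ w, (z ∘ Sum.inr) w = 1 := by
    intro z hz
    rw [mem_realization_iff, mem_cone_join, Fintype.sum_sum_type] at hz
    exact ⟨hz.1.1, hz.1.2, hz.2⟩
  have hnorm : ∀ x ∈ K.cone, ∀ y ∈ L.cone,
      ‖(WithLp.toLp 1 (G x, H y) : E)‖ = ∑ v, x v + ∑ w, y w := by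
    intro x hx y hy
    rw [WithLp.prod_norm_eq_of_L1, ← hGn x hx, ← hHn y hy]
    rfl
  let Φ : (K.join L).realization → Metric.sphere (0 : E) 1 := fun z =>
    ⟨WithLp.toLp 1 (G (z.1 ∘ Sum.inl), H (z.1 ∘ Sum.inr)), by
      obtain ⟨h1, h2, h3⟩ := hz z.1 z.2
      rw [mem_sphere_zero_iff_norm, hnorm _ h1 _ h2, h3]⟩
  refine nonempty_homeomorph_of_bijective (f := Φ) ?_ ⟨?_, ?_⟩
  · refine Continuous.subtype_mk ((WithLp.prod_continuous_toLp 1 _ _).comp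
      (Continuous.prodMk ?_ ?_)) _
    · exact hG.comp_continuous (continuous_pi fun v =>
        (continuous_apply (Sum.inl v)).comp continuous_subtype_val) fun z => (hz z.1 z.2).1
    · exact hH.comp_continuous (continuous_pi fun w =>
        (continuous_apply (Sum.inr w)).comp continuous_subtype_val) fun z => (hz z.1 z.2).2.1
  · intro z z' h
    have h1 : WithLp.toLp 1 (G (z.1 ∘ Sum.inl), H (z.1 ∘ Sum.inr)) =
        (WithLp.toLp 1 (G (z'.1 ∘ Sum.inl), H (z'.1 ∘ Sum.inr)) : E) := congrArg Subtype.val h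
    have h2 := WithLp.toLp_injective 1 h1
    rw [Prod.mk.injEq] at h2
    have h3 := hGi (hz z.1 z.2).1 (hz z'.1 z'.2).1 h2.1
    have h4 := hHi (hz z.1 z.2).2.1 (hz z'.1 z'.2).2.1 h2.2
    ext (v | w)
    · exact congrFun h3 v
    · exact congrFun h4 w
  · intro y
    obtain ⟨x₁, hx₁, h1⟩ := hGs y.1.fst
    obtain ⟨x₂, hx₂, h2⟩ := hHs y.1.snd
    have hy : (WithLp.toLp 1 (G x₁, H x₂) : E) = y.1 := by rw [h1, h2]; rfl
    refine ⟨⟨Sum.elim x₁ x₂, ?_⟩, Subtype.ext hy⟩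
    rw [mem_realization_iff, mem_cone_join]
    refine ⟨⟨hx₁, hx₂⟩, ?_⟩
    have := hnorm x₁ hx₁ x₂ hx₂
    rw [hy, mem_sphere_zero_iff_norm.mp y.2] at this
    rw [Fintype.sum_sum_type]
    exact this.symm

/-- Surjectivity of radial projection: the ray through `u` leaves the polytope at a boundary point,
and a supporting functional there identifies a simplex carrying the weights. -/
theorem IsRadial.exists_smul_mem [Fintype V] [FiniteDimensional ℝ E] [Nonempty V]
    {K : PreAbstractSimplicialComplex V} {p : V → E} (h : K.IsRadial p) {u : E} (hu : u ≠ 0) :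
    ∃ c : ℝ, 0 < c ∧ ∃ x ∈ K.realization, ∑ v, x v • p v = c • u := by
  classical
  set P := convexHull ℝ (Set.range p) with hP
  have hPc : IsCompact P := (Set.finite_range p).isCompact_convexHull ℝ
  have h0 := h.zero_mem_interior
  have hu' : 0 < ‖u‖ := norm_pos_iff.mpr hu
  let T : Set ℝ := (fun c : ℝ => c • u) ⁻¹' P
  have hT : IsCompact T := by
    refine Metric.isCompact_of_isClosed_isBounded
      (hPc.isClosed.preimage (by fun_prop)) ?_
    obtain ⟨R, hR⟩ := hPc.isBounded.subset_closedBall 0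
    refine (Metric.isBounded_closedBall (x := (0 : ℝ)) (r := R / ‖u‖)).subset fun c hc => ?_
    have := hR hc
    rw [mem_closedBall_zero_iff, norm_smul] at this
    rw [mem_closedBall_zero_iff, le_div_iff₀ hu']
    exact this
  obtain ⟨c, hc, hmax⟩ := hT.exists_isMaxOn (f := id)
    ⟨0, by simpa [T] using interior_subset h0⟩ continuousOn_id
  -- An interior parameter can still be increased, so the last point of the ray is on the boundary;
  -- the parameter 0 shows that `c` is positive.
  have hlarger : ∀ c' : ℝ, c' • u ∈ interior P → c' < c := by
    intro c' hc'
    have h1 : (fun c : ℝ => c • u) ⁻¹' interior P ∈ nhds c' :=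
      (isOpen_interior.preimage (by fun_prop)).mem_nhds hc'
    obtain ⟨d, hd, hd'⟩ := Filter.nonempty_of_mem (Filter.inter_mem
      (nhdsWithin_le_nhds (s := Set.Ioi c') h1) self_mem_nhdsWithin)
    exact lt_of_lt_of_le hd' (hmax (a := d) (show d • u ∈ P from interior_subset hd))
  have hcpos : 0 < c := hlarger 0 (by simpa using h0)
  obtain ⟨l, hl0, hl⟩ := geometric_hahn_banach_of_nonempty_interior_point
    (convex_convexHull ℝ (Set.range p)) (fun h => lt_irrefl _ (hlarger c h)) ⟨0, h0⟩
  have hpos : 0 < l (c • u) := by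
    by_contra hneg
    apply hl0
    exact h.eq_zero l fun v => (hl _ (subset_convexHull ℝ _ ⟨v, rfl⟩)).trans (not_lt.mp hneg)
  obtain ⟨x, hx, hxc⟩ := exists_weights_of_mem_convexHull (show c • u ∈ _ from hc)
  refine ⟨c, hcpos, x, mem_realization_iff.mpr ⟨⟨hx.1,
    Finset.univ.filter fun v => l (p v) = l (c • u), ?_, ?_⟩, hx.2⟩, hxc⟩
  · refine (h.isSimplex_iff _).mpr ⟨(l (c • u))⁻¹ • l, fun v => ?_⟩
    rw [smul_apply, smul_eq_mul, inv_mul_le_one₀ hpos, inv_mul_eq_one₀ hpos.ne']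
    exact ⟨hl _ (subset_convexHull ℝ _ ⟨v, rfl⟩), by simp [eq_comm]⟩
  · intro v hv
    -- All summands are nonnegative, so no weight sits on vertices below the supporting hyperplane.
    have h1 : ∑ v, x v * (l (c • u) - l (p v)) = 0 := by
      simp only [mul_sub, Finset.sum_sub_distrib, ← Finset.sum_mul, hx.2, one_mul]
      rw [sub_eq_zero, ← hxc, map_sum]
      simp
    have h2 := (Finset.sum_eq_zero_iff_of_nonneg fun v _ => mul_nonneg (hx.1 v)
      (sub_nonneg.mpr (hl _ (subset_convexHull ℝ _ ⟨v, rfl⟩)))).mp h1 v (Finset.mem_univ v)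
    refine (mul_eq_zero.mp h2).resolve_right fun h3 => hv ?_
    simp only [Finset.mem_filter, Finset.mem_univ, true_and]
    linarith

/-- Injectivity of radial projection: comparing in both directions gives `c = 1`, then `y` vanishes
wherever `x` does, and independence within the simplex gives equality. -/
theorem IsRadial.eq_of_smul_eq [Fintype V] {K : PreAbstractSimplicialComplex V} {p : V → E}
    (h : K.IsRadial p) {x y : V → ℝ} (hx : x ∈ K.realization) (hy : y ∈ K.realization) {c : ℝ}
    (hc : 0 < c) (hxy : ∑ v, x v • p v = c • ∑ v, y v • p v) : x = y := by
  classical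
  -- a functional supporting the face spanned by the support of `x` shows that `1 ≤ c`
  have key : ∀ {x y : V → ℝ} {c : ℝ}, x ∈ K.realization → y ∈ K.realization → 0 < c →
      ∑ v, x v • p v = c • ∑ v, y v • p v →
      1 ≤ c ∧ (c = 1 → ∀ v, x v = 0 → y v = 0) := by
    intro x y c hx hy hc hxy
    obtain ⟨⟨hx0, σ, hσ, hxσ⟩, hx1⟩ := mem_realization_iff.mp hx
    obtain ⟨⟨hy0, -⟩, hy1⟩ := mem_realization_iff.mp hy
    have hsupp : K.IsSimplex (Finset.univ.filter fun v => x v ≠ 0) := hσ.mono fun v hv => by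
      by_contra h
      simp [hxσ v h] at hv
    obtain ⟨l, hl⟩ := (h.isSimplex_iff _).mp hsupp
    have h1 : l (∑ v, x v • p v) = 1 := by
      rw [map_sum, ← hx1]
      refine Finset.sum_congr rfl fun v _ => ?_
      rw [map_smul, smul_eq_mul]
      by_cases hv : x v = 0
      · simp [hv]
      · rw [(hl v).2.mpr (by simpa using hv), mul_one]
    have h2 : l (∑ v, y v • p v) = 1 - ∑ v, y v * (1 - l (p v)) := by
      simp only [map_sum, map_smul, smul_eq_mul, mul_sub, mul_one, Finset.sum_sub_distrib, hy1]
      ring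
    have h3 : ∀ v, 0 ≤ y v * (1 - l (p v)) := fun v =>
      mul_nonneg (hy0 v) (sub_nonneg.mpr (hl v).1)
    have h4 : 0 ≤ ∑ v, y v * (1 - l (p v)) := Finset.sum_nonneg fun v _ => h3 v
    rw [hxy, map_smul, smul_eq_mul, h2] at h1
    refine ⟨by nlinarith, fun hc1 v hv => ?_⟩
    have h5 : ∑ v, y v * (1 - l (p v)) = 0 := by rw [hc1] at h1; linarith
    have h6 := (Finset.sum_eq_zero_iff_of_nonneg fun v _ => h3 v).mp h5 v (Finset.mem_univ v)
    refine (mul_eq_zero.mp h6).resolve_right fun h7 => ?_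
    have := (hl v).2.mp (by linarith)
    simp [hv] at this
  have h1 := key hx hy hc hxy
  have h2 := key hy hx (inv_pos.mpr hc) (by rw [hxy, smul_smul, inv_mul_cancel₀ hc.ne', one_smul])
  have hc1 : c = 1 := le_antisymm ((one_le_inv₀ hc).mp h2.1) h1.1
  obtain ⟨⟨hx0, σ, hσ, hxσ⟩, hx1⟩ := mem_realization_iff.mp hx
  obtain ⟨l, hl⟩ := h.prescribe σ hσ fun v => x v - y v
  have h3 : ∑ v, (x v - y v) * (x v - y v) = 0 := by
    rw [hc1, one_smul, ← sub_eq_zero, ← Finset.sum_sub_distrib] at hxy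
    have := congrArg l hxy
    rw [map_sum, map_zero] at this
    rw [← this]
    refine Finset.sum_congr rfl fun v _ => ?_
    rw [← sub_smul, map_smul, smul_eq_mul]
    by_cases hv : v ∈ σ
    · rw [hl v hv]
    · rw [hxσ v hv, h1.2 hc1 v (hxσ v hv)]
      simp
  ext v
  have := (Finset.sum_eq_zero_iff_of_nonneg fun v _ => mul_self_nonneg (x v - y v)).mp h3 v
    (Finset.mem_univ v)
  exact sub_eq_zero.mp (mul_self_eq_zero.mp this)

theorem IsRadial.isSphereTriangulation [Fintype V] [FiniteDimensional ℝ E]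
    {K : PreAbstractSimplicialComplex V} {p : V → E} (h : K.IsRadial p) {n : ℕ}
    (hn : Module.finrank ℝ E = n + 1) : K.IsSphereTriangulation n := by
  have : Nontrivial E := Module.nontrivial_of_finrank_pos (R := ℝ) (by rw [hn]; omega)
  have : Nonempty V := h.nonempty
  rw [isSphereTriangulation_iff hn]
  have hne : ∀ x : K.realization, ∑ v, x.1 v • p v ≠ 0 := by
    classical
    intro x hx
    obtain ⟨⟨hx0, σ, hσ, hxσ⟩, hx1⟩ := mem_realization_iff.mp x.2
    obtain ⟨l, hl⟩ := (h.isSimplex_iff σ).mp hσ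
    have h1 : ∑ v, x.1 v * l (p v) = 0 := by simpa using congrArg l hx
    have h2 : ∑ v, x.1 v * l (p v) = ∑ v, x.1 v := by
      refine Finset.sum_congr rfl fun v _ => ?_
      by_cases hv : v ∈ σ
      · rw [(hl v).2.mpr hv, mul_one]
      · rw [hxσ v hv, zero_mul]
    linarith
  let Φ : K.realization → Metric.sphere (0 : E) 1 := fun x =>
    ⟨‖∑ v, x.1 v • p v‖⁻¹ • ∑ v, x.1 v • p v, inv_norm_smul_mem_sphere (hne x)⟩
  refine nonempty_homeomorph_of_bijective (f := Φ) ?_ ⟨fun x y hxy => ?_, fun u => ?_⟩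
  · have hc : Continuous fun x : K.realization => ∑ v, x.1 v • p v :=
      continuous_finsetSum _ fun v _ =>
        ((continuous_apply v).comp continuous_subtype_val).smul continuous_const
    exact Continuous.subtype_mk (Continuous.smul (hc.norm.inv₀ fun x => norm_ne_zero_iff.mpr (hne x))
      hc) _
  · have h1 : ‖∑ v, x.1 v • p v‖⁻¹ • ∑ v, x.1 v • p v = ‖∑ v, y.1 v • p v‖⁻¹ • ∑ v, y.1 v • p v :=
      congrArg Subtype.val hxy
    have hx := norm_pos_iff.mpr (hne x)
    have hy := norm_pos_iff.mpr (hne y)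
    refine Subtype.ext (h.eq_of_smul_eq x.2 y.2 (mul_pos hx (inv_pos.mpr hy)) ?_)
    rw [mul_smul, ← h1, smul_smul, mul_inv_cancel₀ hx.ne', one_smul]
  · obtain ⟨c, hc, x, hx, hxu⟩ := h.exists_smul_mem (ne_zero_of_mem_sphere_one u.2)
    refine ⟨⟨x, hx⟩, Subtype.ext ?_⟩
    have hu : ‖u.1‖ = 1 := mem_sphere_zero_iff_norm.mp u.2
    simp only [Φ, hxu, norm_smul, hu, mul_one, Real.norm_of_nonneg hc.le, smul_smul,
      inv_mul_cancel₀ hc.ne', one_smul]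

end Topology

/-! ### The examples built from pentagons -/

section Pentagons

variable {V W E : Type*} [NormedAddCommGroup E] [NormedSpace ℝ E] [FiniteDimensional ℝ E]

theorem IsRadial.isConvexFlagSphere [Fintype V] [DecidableEq V]
    {K : PreAbstractSimplicialComplex V} {p : V → E} (h : K.IsRadial p) (hF : K.IsFlag) {n : ℕ}
    (hn : Module.finrank ℝ E = n + 1) : K.IsConvexFlagSphere n :=
  ⟨hF, h.isSphereTriangulation hn, h.isConvexSphereTriangulation hn⟩

theorem singleton_mem_polygon_five (x : ZMod 5) : {x} ∈ (polygon 5).faces := by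
  rw [singleton_mem_faces_iff, isSimplex_polygon]
  exact ⟨x, by simp⟩

theorem isEdge_join_singletons {K : PreAbstractSimplicialComplex V}
    {L : PreAbstractSimplicialComplex W} {v : V} {w : W} (hv : {v} ∈ K.faces)
    (hw : {w} ∈ L.faces) : (K.join L).IsEdge (({v} : Finset V).disjSum {w}) := by
  refine ⟨?_, by simp⟩
  rw [mem_faces_iff, isSimplex_join]
  refine ⟨⟨.inl v, by simp⟩, ?_, ?_⟩
  · simpa using singleton_mem_faces_iff.mp hv
  · simpa using singleton_mem_faces_iff.mp hw

/-- Take one vertex from each pentagon: the link is the join of two pairs of points. -/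
theorem exists_isEdge_link_polygon_four :
    ∃ η, ((polygon 5).join (polygon 5)).IsEdge η ∧
      (((polygon 5).join (polygon 5)).link η).IsIsomorphic (polygon 4) := by
  obtain ⟨φ, hφ⟩ := exists_isCross_polygon_four
  refine ⟨_, isEdge_join_singletons (singleton_mem_polygon_five 0) (singleton_mem_polygon_five 0),
    IsCross.isIsomorphic (IsCross.link_join (singleton_mem_polygon_five 0)
      (singleton_mem_polygon_five 0) (isCross_link_polygon_five 0) (isCross_link_polygon_five 0))
      (hφ.reindex (Fintype.equivOfCardEq (by simp)))⟩

/-- The edge joins the new vertex to a pentagon vertex. Its link is the suspended quadrilateral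
joined with two points: 3 + 1 antipodal pairs. -/
theorem exists_isEdge_link_crossPolytope_of_join [DecidableEq V]
    {K : PreAbstractSimplicialComplex V} {η : Finset V} (hη : K.IsEdge η)
    {φ : Fin 2 × Bool → V} (hφ : (K.link η).IsCross φ) :
    ∃ θ, ((K.subdivide η).join (polygon 5)).IsEdge θ ∧
      (((K.subdivide η).join (polygon 5)).link θ).IsIsomorphic (crossPolytope 4) := by
  obtain ⟨s, t, hst, rfl, he⟩ := isEdge_iff.mp hη
  have hn : {none} ∈ (K.subdivide {s, t}).faces := by
    rw [singleton_mem_faces_iff, isSimplex_subdivide (by simp)]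
    simpa [isSimplex_empty] using he
  exact ⟨_, isEdge_join_singletons hn (singleton_mem_polygon_five 0),
    IsCross.isIsomorphic (IsCross.link_join hn (singleton_mem_polygon_five 0)
      (hφ.link_subdivide_none hst he) (isCross_link_polygon_five 0))
      ((isCross_crossPolytope 4).reindex (Fintype.equivOfCardEq (by simp)))⟩

theorem exists_isEdge_link_crossPolytope_subdivide [DecidableEq V]
    {K : PreAbstractSimplicialComplex V} {η : Finset V} (hη : K.IsEdge η) {n : ℕ}
    (h : (K.link η).IsIsomorphic (crossPolytope n)) :
    ∃ κ, (K.subdivide η).IsEdge κ ∧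
      ((K.subdivide η).link κ).IsIsomorphic (crossPolytope n) := by
  obtain ⟨φ, hφ⟩ := (isCross_crossPolytope n).of_isIsomorphic h
  obtain ⟨s, t, hst, rfl, he⟩ := isEdge_iff.mp hη
  refine ⟨{none, some s}, ?_, (hφ.link_subdivide_pair hst he).isIsomorphic
    (isCross_crossPolytope n)⟩
  have h1 : ({none, some s} : Finset (Option V)).eraseNone = {s} := by ext; simp
  refine isEdge_iff.mpr ⟨none, some s, by simp, rfl, ?_⟩
  rw [isSimplex_subdivide (by simp), h1]
  refine ⟨fun h2 => ?_, he.mono (by simp), fun _ => by simpa using he⟩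
  have h3 := h2 (Finset.mem_insert_of_mem (Finset.mem_singleton_self t))
  exact hst (Finset.mem_singleton.mp h3).symm

theorem fPoly_subdivide_of_isIsomorphic [Fintype V] [DecidableEq V]
    {K : PreAbstractSimplicialComplex V} {η : Finset V} (hη : K.IsEdge η) {n : ℕ}
    (h : (K.link η).IsIsomorphic (crossPolytope n)) :
    (K.subdivide η).fPoly = K.fPoly + X * (1 + X) * (1 + 2 * X) ^ n := by
  obtain ⟨φ, hφ⟩ := (isCross_crossPolytope n).of_isIsomorphic h
  rw [fPoly_subdivide hη, hφ.fPoly, Fintype.card_fin]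

theorem hPoly_of_fPoly [Fintype V] {K : PreAbstractSimplicialComplex V}
    (hK : K.fPoly = 1 + 16 * X + 100 * X ^ 2 + 313 * X ^ 3 + 519 * X ^ 4 + 435 * X ^ 5 +
      145 * X ^ 6) :
    K.hPoly = 1 + 10 * X + 35 * X ^ 2 + 53 * X ^ 3 + 35 * X ^ 4 + 10 * X ^ 5 + X ^ 6 := by
  have hd : K.fPoly.natDegree = 6 := by
    rw [hK]
    compute_degree!
  rw [hPoly_eq_sum_coeff, hd, hK]
  simp only [Finset.sum_range_succ, Finset.sum_range_zero, coeff_add, coeff_ofNat_mul, coeff_X_pow,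
    coeff_X, coeff_one]
  norm_num
  ring

theorem isGammaPoly_of_fPoly [Fintype V] {K : PreAbstractSimplicialComplex V}
    (hK : K.fPoly = 1 + 16 * X + 100 * X ^ 2 + 313 * X ^ 3 + 519 * X ^ 4 + 435 * X ^ 5 +
      145 * X ^ 6) : K.IsGammaPoly (1 + 4 * X + 4 * X ^ 2 + X ^ 3) := by
  have hd : K.hPoly.natDegree = 6 := by
    rw [hPoly_of_fPoly hK]
    compute_degree!
  have hγ : (1 + 4 * X + 4 * X ^ 2 + X ^ 3 : ℤ[X]).natDegree ≤ 3 := by compute_degree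
  refine ⟨by rw [hd]; omega, fun t ht => ?_⟩
  rw [hd, hPoly_of_fPoly hK]
  simp only [map_add, map_mul, map_pow, map_one, aeval_X, map_ofNat]
  field_simp
  ring

/-- Joins with the zero-dimensional sphere raise the dimension and keep a non-real root of the
f-polynomial. -/
theorem exists_isConvexFlagSphere {V : Type} [Fintype V] [DecidableEq V]
    {K : PreAbstractSimplicialComplex V} {p : V → E} (hF : K.IsFlag) (hR : K.IsRadial p) {m : ℕ}
    (hm : Module.finrank ℝ E = m + 1) {z : ℂ} (hz : aeval z K.fPoly = 0) (him : z.im ≠ 0)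
    (n : ℕ) (hmn : m ≤ n) : ∃ (V : Type) (_ : Fintype V) (_ : DecidableEq V)
      (K : PreAbstractSimplicialComplex V), K.IsConvexFlagSphere n ∧ K.HasNonrealHRoot := by
  -- The induction carries one fixed root of the f-polynomial, which passes to joins by
  -- multiplicativity.
  suffices h : ∃ (V : Type) (_ : Fintype V) (_ : DecidableEq V)
      (K : PreAbstractSimplicialComplex V) (q : V → EuclideanSpace ℝ (Fin (n + 1))),
      K.IsFlag ∧ K.IsRadial q ∧ aeval z K.fPoly = 0 by
    obtain ⟨V, i, j, K, q, hF, hR, hz⟩ := h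
    exact ⟨V, i, j, K, hR.isConvexFlagSphere hF (by simp), hasNonrealHRoot_of_fPoly hz him⟩
  induction n, hmn using Nat.le_induction with
  | base =>
    let e : E ≃L[ℝ] EuclideanSpace ℝ (Fin (m + 1)) :=
      ContinuousLinearEquiv.ofFinrankEq (by simpa using hm)
    exact ⟨V, inferInstance, inferInstance, K, _, hF, hR.map e, hz⟩
  | succ n _ ih =>
    obtain ⟨V, i, j, K, q, hF, hR, hz⟩ := ih
    let e : (EuclideanSpace ℝ (Fin (n + 1)) × ℝ) ≃L[ℝ] EuclideanSpace ℝ (Fin (n + 1 + 1)) :=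
      ContinuousLinearEquiv.ofFinrankEq (by simp)
    refine ⟨V ⊕ Bool, inferInstance, inferInstance, K.join zeroSphere, _,
      hF.join isFlag_zeroSphere, (hR.join isRadial_zeroSphere).map e, ?_⟩
    rw [fPoly_join, map_mul, hz, zero_mul]

end Pentagons

end PreAbstractSimplicialComplex

/-! ### The counterexamples -/

open PreAbstractSimplicialComplex in
theorem corollary3p3p4 :
    -- an edge of the join of two pentagons whose link is a quadrilateral exists
    (∃ η, ((PreAbstractSimplicialComplex.polygon 5).join (.polygon 5)).IsEdge η ∧
      (((PreAbstractSimplicialComplex.polygon 5).join (.polygon 5)).link η).IsIsomorphic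
        (.polygon 4)) ∧
    -- any such edge leads to counterexamples in all dimensions
    (∀ η, ((PreAbstractSimplicialComplex.polygon 5).join (.polygon 5)).IsEdge η →
      (((PreAbstractSimplicialComplex.polygon 5).join (.polygon 5)).link η).IsIsomorphic
        (.polygon 4) →
      ∀ K, K = ((((PreAbstractSimplicialComplex.polygon 5).join (.polygon 5)).subdivide η).join
          (.polygon 5)) →
        K.IsConvexFlagSphere 5 ∧
        K.IsGammaPoly (1 + 4 * Polynomial.X + 4 * Polynomial.X ^ 2 + Polynomial.X ^ 3) ∧
        (∃ θ, K.IsEdge θ ∧ (K.link θ).IsIsomorphic (.crossPolytope 4)) ∧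
        ∀ θ, K.IsEdge θ → (K.link θ).IsIsomorphic (.crossPolytope 4) →
          ((K.subdivide θ).IsConvexFlagSphere 5 ∧
            (K.subdivide θ).HasNonrealHRoot ∧
            (K.subdivide θ).fPoly = 1 + 17 * Polynomial.X + 109 * Polynomial.X ^ 2 +
              345 * Polynomial.X ^ 3 + 575 * Polynomial.X ^ 4 + 483 * Polynomial.X ^ 5 +
              161 * Polynomial.X ^ 6) ∧
          -- the same after a second subdivision
          ((∃ κ, (K.subdivide θ).IsEdge κ ∧
              ((K.subdivide θ).link κ).IsIsomorphic (.crossPolytope 4)) ∧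
            ∀ κ, (K.subdivide θ).IsEdge κ →
              ((K.subdivide θ).link κ).IsIsomorphic (.crossPolytope 4) →
              ((K.subdivide θ).subdivide κ).IsConvexFlagSphere 5 ∧
              ((K.subdivide θ).subdivide κ).HasNonrealHRoot) ∧
          -- joins with arbitrary flag sphere triangulations
          ∀ (W : Type*) [Fintype W] [DecidableEq W] (L : PreAbstractSimplicialComplex W) (k : ℕ),
            L.IsFlag → L.IsSphereTriangulation k →
              ((K.subdivide θ).join L).IsFlag ∧
              ((K.subdivide θ).join L).IsSphereTriangulation (k + 6) ∧
              (L.IsConvexSphereTriangulation k →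
                ((K.subdivide θ).join L).IsConvexSphereTriangulation (k + 6)) ∧
              ((K.subdivide θ).join L).HasNonrealHRoot) ∧
    -- counterexamples in every dimension at least five
    ∀ n : ℕ, 5 ≤ n → ∃ (V : Type) (_ : Fintype V) (_ : DecidableEq V)
      (K : PreAbstractSimplicialComplex V), K.IsConvexFlagSphere n ∧ K.HasNonrealHRoot := by
  have hpent := isRadial_pentagon.join isRadial_pentagon
  have key : ∀ η, ((polygon 5).join (polygon 5)).IsEdge η →
      (((polygon 5).join (polygon 5)).link η).IsIsomorphic (polygon 4) →
      ∀ K, K = (((polygon 5).join (polygon 5)).subdivide η).join (polygon 5) →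
      K.IsFlag ∧ (∃ p : _ → (((ℝ × ℝ) × (ℝ × ℝ)) × (ℝ × ℝ)), K.IsRadial p) ∧
      K.fPoly = 1 + 16 * X + 100 * X ^ 2 + 313 * X ^ 3 + 519 * X ^ 4 + 435 * X ^ 5 + 145 * X ^ 6 ∧
      ∃ θ, K.IsEdge θ ∧ (K.link θ).IsIsomorphic (crossPolytope 4) := by
    rintro η hη hlink K rfl
    obtain ⟨ψ, hψ⟩ := exists_isCross_polygon_four
    obtain ⟨φ, hφ⟩ := hψ.of_isIsomorphic hlink
    obtain ⟨q, hq⟩ := hpent.exists_subdivide hη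
    refine ⟨((isFlag_polygon_five.join isFlag_polygon_five).subdivide hη).join isFlag_polygon_five,
      ⟨_, hq.join isRadial_pentagon⟩, ?_, exists_isEdge_link_crossPolytope_of_join hη hφ⟩
    rw [fPoly_join, fPoly_subdivide hη, fPoly_join, hφ.fPoly, fPoly_polygon_five, Fintype.card_fin]
    ring
  have hfin : Module.finrank ℝ (((ℝ × ℝ) × (ℝ × ℝ)) × (ℝ × ℝ)) = 5 + 1 := by simp
  have hroot : ∀ f : ℤ[X], f = 1 + 17 * X + 109 * X ^ 2 + 345 * X ^ 3 + 575 * X ^ 4 +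
      483 * X ^ 5 + 161 * X ^ 6 → ∃ w : ℂ, aeval w f = 0 ∧ w.im ≠ 0 := fun f hf =>
    -- In u = X + X² the polynomial is 1 + 17u + 92u² + 161u³, with discriminant -23.
    exists_nonreal_root_of_cubic 161 92 17 (by norm_num) (by norm_num) (by
      rw [hf]
      simp only [map_ofNat]
      ring)
  refine ⟨exists_isEdge_link_polygon_four, fun η hη hlink K hK => ?_, ?_⟩
  · obtain ⟨hF, ⟨p, hp⟩, hf, hθ⟩ := key η hη hlink K hK
    refine ⟨hp.isConvexFlagSphere hF hfin, isGammaPoly_of_fPoly hf, hθ, fun θ hθ hθlink => ?_⟩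
    obtain ⟨q, hq⟩ := hp.exists_subdivide hθ
    have hF' := hF.subdivide hθ
    have hf' : (K.subdivide θ).fPoly = 1 + 17 * X + 109 * X ^ 2 + 345 * X ^ 3 + 575 * X ^ 4 +
        483 * X ^ 5 + 161 * X ^ 6 := by
      rw [fPoly_subdivide_of_isIsomorphic hθ hθlink, hf]
      ring
    obtain ⟨w, hw, him⟩ := hroot _ hf'
    refine ⟨⟨hq.isConvexFlagSphere hF' hfin, hasNonrealHRoot_of_fPoly hw him, hf'⟩,
      ⟨exists_isEdge_link_crossPolytope_subdivide hθ hθlink, fun κ hκ hκlink => ?_⟩, ?_⟩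
    · obtain ⟨r, hr⟩ := hq.exists_subdivide hκ
      refine ⟨hr.isConvexFlagSphere (hF'.subdivide hκ) hfin, ?_⟩
      -- The second subdivision adds u(1 + 4u)² again; the discriminant is now -139.
      obtain ⟨z, hz, hzim⟩ := exists_nonreal_root_of_cubic
        (f := ((K.subdivide θ).subdivide κ).fPoly) 177 100 18 (by norm_num) (by norm_num) (by
          rw [fPoly_subdivide_of_isIsomorphic hκ hκlink, hf']
          simp only [map_ofNat]
          ring)
      exact hasNonrealHRoot_of_fPoly hz hzim
    · intro W _ _ L k hL hLs
      refine ⟨hF'.join hL, ?_, fun hLc => ?_, hasNonrealHRoot_of_fPoly (w := w) ?_ him⟩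
      · rw [show k + 6 = 5 + k + 1 by omega]
        exact (hq.isSphereTriangulation hfin).join hLs
      · obtain ⟨r, hr⟩ := exists_isRadial_of_isConvexSphereTriangulation hLc
        refine (hq.join hr).isConvexSphereTriangulation ?_
        rw [Module.finrank_prod, hfin, finrank_euclideanSpace_fin]
        omega
      · rw [fPoly_join, map_mul, hw, zero_mul]
  · intro n hn
    obtain ⟨η, hη, hlink⟩ := exists_isEdge_link_polygon_four
    obtain ⟨hF, ⟨p, hp⟩, hf, θ, hθ, hθlink⟩ := key η hη hlink _ rfl
    obtain ⟨q, hq⟩ := hp.exists_subdivide hθ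
    obtain ⟨w, hw, him⟩ := hroot _ ((fPoly_subdivide_of_isIsomorphic hθ hθlink).trans (by
      rw [hf]
      ring))
    exact exists_isConvexFlagSphere (hF.subdivide hθ) hq hfin hw him n hn
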